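/- Let $d\ge 1$, let $P$ (source) and $Q$ (target) be probability distributions of $(\mathbf X,Y)\in[0,1]^d\times\{0,1\}$ with covariate marginals $P_{\mathbf X},Q_{\mathbf X}$ and regression functions $\eta_P(\mathbf x)=P(Y=1\mid\mathbf X=\mathbf x)$, $\eta_Q(\mathbf x)=Q(Y=1\mid\mathbf X=\mathbf x)$, and let $\lambda$ be Lebesgue measure on $\mathbb R^d$. Fix constants $\theta=(\alpha,\beta_P,\beta_Q,\gamma,c_\lambda,r_\lambda,C_\beta,C_\alpha,C_\gamma)$ with $\alpha\ge 0$, $\beta_P,\beta_Q\in[0,1]$, $\max(\beta_P,\beta_Q)>0$ and $\gamma,c_\lambda,r_\lambda,C_\beta,C_\alpha,C_\gamma>0$. Let $\Pi(\theta)$ be the set of pairs $(P,Q)$ for which there are a set $\Omega\subset[0,1]^d$ and versions of $\eta_P,\eta_Q$ and of the densities below such that 1. $\Omega=\mathrm{supp}(P_{\mathbf X})=\mathrm{supp}(Q_{\mathbf X})$; $\lambda[\Omega\cap B(\mathbf x,r)]\ge c_\lambda\lambda[B(\mathbf x,r)]$ for all $\mathbf x\in\Omega$ and $0<r<r_\lambda$;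 and $P_{\mathbf X},Q_{\mathbf X}$ have densities with $c_\lambda<\frac{dP_{\mathbf X}}{d\lambda}(\mathbf x)<c_\lambda^{-1}$ and $c_\lambda<\frac{dQ_{\mathbf X}}{d\lambda}(\mathbf x)<c_\lambda^{-1}$ for all $\mathbf x\in\Omega$; 2. $|\eta_P(\mathbf x_1)-\eta_P(\mathbf x_2)|\le C_\beta\|\mathbf x_1-\mathbf x_2\|^{\beta_P}$ and $|\eta_Q(\mathbf x_1)-\eta_Q(\mathbf x_2)|\le C_\beta\|\mathbf x_1-\mathbf x_2\|^{\beta_Q}$ for all $\mathbf x_1,\mathbf x_2\in\Omega$ (with the convention $0^0=1$); 3. $Q_{\mathbf X}(|\eta_Q(\mathbf X)-1/2|<t)\le C_\alpha t^\alpha$ for all $t\in(0,1/2]$; 4. $(\eta_P(\mathbf x)-1/2)(\eta_Q(\mathbf x)-1/2)\ge 0$ and $|\eta_P(\mathbf x)-1/2|\ge C_\gamma|\eta_Q(\mathbf x)-1/2|^\gamma$ for all $\mathbf x\in\Omega$. The training data are $n_P$ i.i.d. observations from $P$ (no target data, $n_Q=0$). For $1\le k\le n_P$ let $\widehat\eta_k(\mathbf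 x)$ be the average of the labels of the $k$ covariates nearest to $\mathbf x$ in Euclidean distance (ties broken by index). The weighted $k$NN classifier (positive weights $w_P,w_Q$), which for $n_Q=0$ uses the $P$-data only, is $\widehat f_{NN}(\mathbf x)=\mathbb I(\widehat\eta_{k_P}(\mathbf x)\ge 1/2)$. The data-driven classifier is $\widehat f_{pa}(\mathbf x)=\mathbb I(\widehat\eta_{\widehat k_P}(\mathbf x)\ge 1/2)$, where $\widehat k_P=\widehat k_P(\mathbf x)$ is the smallest $k\in\{1,\dots,n_P\}$ such that $\sqrt k\,|\widehat\eta_k(\mathbf x)-1/2|>\sqrt{[d+\log n_P]\log n_P}$ or $k=n_P$. The excess risk of a classifier $\widehat f$ built from the data is $\mathcal R_Q(\widehat f)=\mathbb E[\mathcal E_Q(\widehat f)]-\mathcal E_Q(f_Q^*)$, where $\mathcal E_Q(f)=Q(f(\mathbf X)\ne Y)$, $f_Q^*(\mathbf x)=\mathbb I(\eta_Q(\mathbf x)\ge 1/2)$, and the expectation is over the training data. Write $a_n\lesssim b_n$ if $a_n\le c\,b_n$ for some constant $c>0$ and all sufficiently large $n$ (so that $c$ and the threshold do not depend on $(P,Q)$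 in the bounds below), and $a_n\asymp b_n$ if $a_n\lesssim b_n\lesssim a_n$. Then, as $n_P\to\infty$: (a) If $\beta_P>\gamma\beta_Q$ and $k_P\asymp n_P^{\frac{2\beta_P}{2\beta_P+d}}$, then $\sup_{(P,Q)\in\Pi(\theta)}\mathcal R_Q(\widehat f_{NN})\lesssim n_P^{-\frac{(1+\alpha)\beta_P}{\gamma(2\beta_P+d)}}$. (b) If $\beta_P\le\gamma\beta_Q$ and $k_P\asymp n_P^{\frac{2\gamma\beta_Q}{2\gamma\beta_Q+d}}$, then $\sup_{(P,Q)\in\Pi(\theta)}\mathcal R_Q(\widehat f_{NN})\lesssim n_P^{-\frac{(1+\alpha)\beta_Q}{2\gamma\beta_Q+d}}$. (c) If $\beta_P>\gamma\beta_Q$, then $\sup_{(P,Q)\in\Pi(\theta)}\mathcal R_Q(\widehat f_{pa})\lesssim\left(\frac{n_P}{\log^2 n_P}\right)^{-\frac{(1+\alpha)\beta_P}{\gamma(2\beta_P+d)}}$. (d) If $\beta_P\le\gamma\beta_Q$, then $\sup_{(P,Q)\in\Pi(\theta)}\mathcal R_Q(\widehat f_{pa})\lesssim\left(\frac{n_P}{\log^2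 n_P}\right)^{-\frac{(1+\alpha)\beta_Q}{2\gamma\beta_Q+d}}$. -/

import Mathlib

open MeasureTheory ProbabilityTheory Filter Asymptotics

noncomputable section

namespace PosteriorDrift

/-- Covariate space: `ℝ^d` with the Euclidean distance and Lebesgue measure. -/
abbrev Cov (d : ℕ) : Type := EuclideanSpace ℝ (Fin d)

/-- Labelled observations `(x, y)`; the label `true` stands for `1` and `false` for `0`. -/
abbrev Obs (d : ℕ) : Type := Cov d × Bool

/-- The unit cube `[0,1]^d`. -/
def cube (d : ℕ) : Set (Cov d) := {x | ∀ i, x i ∈ Set.Icc (0 : ℝ) 1}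

/-- The marginal law of the covariates. -/
def covLaw {d : ℕ} (P : ProbabilityMeasure (Obs d)) : Measure (Cov d) :=
  (P : Measure (Obs d)).fst

/-- The conditional probability `P(Y = 1 | X = x)`, from the regular conditional distribution. -/
def condProbOne {d : ℕ} (P : ProbabilityMeasure (Obs d)) (x : Cov d) : ℝ :=
  ((P : Measure (Obs d)).condKernel x).real {true}

/-- `η` is a version of `x ↦ P(Y = 1 | X = x)`. -/
structure IsRegressionFunction {d : ℕ} (P : ProbabilityMeasure (Obs d)) (η : Cov d → ℝ) :
    Prop where
  measurable : Measurable η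
  mem_Icc : ∀ x, η x ∈ Set.Icc (0 : ℝ) 1
  ae_eq : η =ᵐ[covLaw P] condProbOne P

/-- The constants `θ`. -/
structure Params where
  (α βP βQ γ cLam rLam Cβ Cα Cγ : ℝ)

/-- The ranges of the constants. -/
structure Params.Admissible (θ : Params) : Prop where
  α_nonneg : 0 ≤ θ.α
  βP_mem : θ.βP ∈ Set.Icc (0 : ℝ) 1
  βQ_mem : θ.βQ ∈ Set.Icc (0 : ℝ) 1
  max_pos : 0 < max θ.βP θ.βQ
  γ_pos : 0 < θ.γ
  cLam_pos : 0 < θ.cLam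
  rLam_pos : 0 < θ.rLam
  Cβ_pos : 0 < θ.Cβ
  Cα_pos : 0 < θ.Cα
  Cγ_pos : 0 < θ.Cγ

/-- `μ` has a Lebesgue density with values strictly between `c` and `c⁻¹` on `Ω`. -/
def HasDensityBounds {d : ℕ} (μ : Measure (Cov d)) (Ω : Set (Cov d)) (c : ℝ) : Prop :=
  ∃ p : Cov d → ℝ, Measurable p ∧ μ = volume.withDensity (fun x => ENNReal.ofReal (p x)) ∧
    ∀ x ∈ Ω, c < p x ∧ p x < c⁻¹

/-- Common support and strong density. -/
structure CommonSupportStrongDensity {d : ℕ} (θ : Params) (P Q : ProbabilityMeasure (Obs d))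
    (Ω : Set (Cov d)) : Prop where
  subset_cube : Ω ⊆ cube d
  support_P : (covLaw P).support = Ω
  support_Q : (covLaw Q).support = Ω
  regular : ∀ x ∈ Ω, ∀ r : ℝ, 0 < r → r < θ.rLam →
    ENNReal.ofReal θ.cLam * volume (Metric.ball x r) ≤ volume (Ω ∩ Metric.ball x r)
  density_P : HasDensityBounds (covLaw P) Ω θ.cLam
  density_Q : HasDensityBounds (covLaw Q) Ω θ.cLam

/-- Hölder condition of order `β` with constant `C` on `Ω`. -/
def HolderSmoothOn {d : ℕ} (η : Cov d → ℝ) (Ω : Set (Cov d)) (C β : ℝ) : Prop :=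
  ∀ x₁ ∈ Ω, ∀ x₂ ∈ Ω, |η x₁ - η x₂| ≤ C * ‖x₁ - x₂‖ ^ β

/-- Tsybakov's noise condition. -/
def TsybakovNoise {d : ℕ} (μ : Measure (Cov d)) (η : Cov d → ℝ) (C α : ℝ) : Prop :=
  ∀ t : ℝ, 0 < t → t ≤ 1 / 2 → μ.real {x | |η x - 1 / 2| < t} ≤ C * t ^ α

/-- Relative signal exponent condition. -/
def RelativeSignal {d : ℕ} (ηP ηQ : Cov d → ℝ) (Ω : Set (Cov d)) (C γ : ℝ) : Prop :=
  ∀ x ∈ Ω, 0 ≤ (ηP x - 1 / 2) * (ηQ x - 1 / 2) ∧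
    C * |ηQ x - 1 / 2| ^ γ ≤ |ηP x - 1 / 2|

/-- The class `Π(θ)` of pairs (source distribution, target distribution). -/
def driftClass (d : ℕ) (θ : Params) :
    Set (ProbabilityMeasure (Obs d) × ProbabilityMeasure (Obs d)) :=
  {PQ | ∃ (Ω : Set (Cov d)) (ηP ηQ : Cov d → ℝ),
    IsRegressionFunction PQ.1 ηP ∧ IsRegressionFunction PQ.2 ηQ ∧
    CommonSupportStrongDensity θ PQ.1 PQ.2 Ω ∧
    HolderSmoothOn ηP Ω θ.Cβ θ.βP ∧ HolderSmoothOn ηQ Ω θ.Cβ θ.βQ ∧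
    TsybakovNoise (covLaw PQ.2) ηQ θ.Cα θ.α ∧
    RelativeSignal ηP ηQ Ω θ.Cγ θ.γ}

/-- Classification risk `Q(f(X) ≠ Y)`. -/
def risk {d : ℕ} (Q : ProbabilityMeasure (Obs d)) (f : Cov d → Bool) : ENNReal :=
  (Q : Measure (Obs d)) {p | f p.1 ≠ p.2}

/-- The Bayes classifier `1{P(Y = 1 | X = x) ≥ 1/2}`; its risk is the same for all versions
of the conditional probability. -/
def bayesClassifier {d : ℕ} (Q : ProbabilityMeasure (Obs d)) (x : Cov d) : Bool :=
  decide (1 / 2 ≤ condProbOne Q x)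

/-- The excess risk under `Q` of a classifier trained on `n` i.i.d. observations from `P`:
the expectation over the training sample of its risk, minus the Bayes risk. -/
def excessRisk {d n : ℕ} (P Q : ProbabilityMeasure (Obs d))
    (f : (Fin n → Obs d) → Cov d → Bool) : ℝ :=
  (∫⁻ z, risk Q (f z) ∂(Measure.pi fun _ : Fin n => (P : Measure (Obs d)))).toReal
    - (risk Q (bayesClassifier Q)).toReal

/-- The (zero-based) list of sample indices in the order of increasing distance of the
covariates to `x`; ties go to the smaller index. -/
def neighbour {d n : ℕ} (z : Fin n → Obs d) (x : Cov d) : Equiv.Perm (Fin n) :=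
  Tuple.sort fun i => ‖(z i).1 - x‖

/-- The `k`-nearest-neighbour regression estimator: the average of the labels of the `k`
covariates nearest to `x`. -/
def knnEst {d n : ℕ} (k : ℕ) (z : Fin n → Obs d) (x : Cov d) : ℝ :=
  1 / (k : ℝ) * ∑ i : Fin n,
    if (i : ℕ) < k then (if (z (neighbour z x i)).2 = true then (1 : ℝ) else 0) else 0

/-- The weighted `k`NN estimator from `P`-data `zP` and `Q`-data `zQ`. -/
def weightedEst {d nP nQ : ℕ} (wP wQ : ℝ) (kP kQ : ℕ) (zP : Fin nP → Obs d)
    (zQ : Fin nQ → Obs d) (x : Cov d) : ℝ :=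
  (wP * kP * knnEst kP zP x + wQ * kQ * knnEst kQ zQ x) / (wP * kP + wQ * kQ)

/-- The weighted `k`NN classifier. -/
def weightedClassifier {d nP nQ : ℕ} (wP wQ : ℝ) (kP kQ : ℕ) (zP : Fin nP → Obs d)
    (zQ : Fin nQ → Obs d) (x : Cov d) : Bool :=
  decide (1 / 2 ≤ weightedEst wP wQ kP kQ zP zQ x)

/-- The weighted `k`NN classifier in the case of no `Q`-data (`nQ = 0`, hence `kQ = 0`). -/
def sourceClassifier {d n : ℕ} (wP wQ : ℝ) (kP : ℕ) (z : Fin n → Obs d) : Cov d → Bool :=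
  weightedClassifier wP wQ kP 0 z (Fin.elim0 : Fin 0 → Obs d)

/-- The data-driven number of neighbours at `x`: the first `k ≥ 1` with
`√k |η̂_k(x) - 1/2| > √((d + log n) log n)` or `k = n`. -/
def adaptiveK {d n : ℕ} (z : Fin n → Obs d) (x : Cov d) : ℕ :=
  sInf {k : ℕ | 1 ≤ k ∧
    (√(((d : ℝ) + Real.log n) * Real.log n) < √(k : ℝ) * |knnEst k z x - 1 / 2| ∨ k = n)}

/-- The adaptive `k`NN classifier. -/
def adaptiveClassifier {d n : ℕ} (z : Fin n → Obs d) (x : Cov d) : Bool :=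
  decide (1 / 2 ≤ knnEst (adaptiveK z x) z x)

/-- For the family `f` of classifiers (one for each sample size `n`), the worst-case excess risk
over the class is at most a constant multiple of `rate n`, for all large `n`. -/
def WorstCaseExcessRiskBound (d : ℕ) (θ : Params)
    (f : (n : ℕ) → (Fin n → Obs d) → Cov d → Bool) (rate : ℕ → ℝ) : Prop :=
  ∃ c : ℝ, 0 < c ∧ ∀ᶠ n : ℕ in atTop, ∀ PQ ∈ driftClass d θ,
    excessRisk PQ.1 PQ.2 (f n) ≤ c * rate n

end PosteriorDrift

end

/-!
Both pairs of rates are instances of one argument, governed by a single exponent `b`: `b = βP / γ`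
when `γ βQ < βP`, and `b = βQ` otherwise. Write `Δ x = |ηQ x - 1/2|`. In either case the smoothness
and the relative signal condition give the *local margin* (`LocalMargin`): all source labels within
distance `c₂ Δ(x) ^ (1/b)` of `x` are biased towards the Bayes label at `x` by at least
`c₁ Δ(x) ^ γ`. In the first case this comes from the smoothness of `ηP`, in the second from that of
`ηQ`, transferred to `ηP` by the relative signal condition (`localMargin_of_source_smooth`,
`localMargin_of_target_smooth`).

A ball of radius of order `τ ^ (1/b)` around a point of the support has mass of order `τ ^ (d/b)`,
so by a multiplicative Chernoff bound (`measure_hitCount_lt`) it contains of order `n τ ^ (d/b)`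
covariates. Given the covariates the labels are independent, which is made precise by writing a
sample as i.i.d. covariates labelled with the help of independent uniform variables
(`map_attachLabels`); Hoeffding's inequality then controls the average of the `k` nearest labels
(`measure_neighbourSum_deviation`). With `τ = n ^ (-b / (2γb + d))` the bias `τ ^ γ` matches the
fluctuation `k ^ (-1/2)`, and at a point with `Δ x ≥ A τ` the classifier differs from the Bayes
classifier with probability at most `exp (-c (Δ x / τ) ^ (2γ))`, up to a negligible term
(`knn_error_at_scale`).

For the adaptive rule, take `τ = (n / log² n) ^ (-b / (2γb + d))`. Off an event of probability
smaller than any power of `n`, all fluctuations at the given point are below the threshold. Then the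
rule stops while the neighbours still lie in the ball of the local margin, and it can only stop on
the correct side of `1/2` (`adaptiveClassifier_eq`). No uniformity over points is needed, because
the expected excess risk is an integral over points.

Indeed the excess risk is at most the integral over `x` of `2 Δ(x)` times the probability of
disagreement with the Bayes classifier at `x` (`excessRisk_le`). Points with `Δ < A τ` contribute
`τ ^ (1 + α)` by the noise condition, and so do the others after a decomposition into dyadic shells
(`exists_lintegral_exp_le`, `exists_excessRisk_le`).
-/

namespace PosteriorDrift

/-! ### Measurability of the nearest-neighbour estimators -/

/-- Permutations of a finite index set carry the discrete σ-algebra. -/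
local instance permMeasurableSpace (n : ℕ) : MeasurableSpace (Equiv.Perm (Fin n)) := ⊤

lemma measurable_neighbour (d n : ℕ) :
    Measurable fun p : (Fin n → Obs d) × Cov d => neighbour p.1 p.2 := by
  have hdist : ∀ i : Fin n, Measurable fun p : (Fin n → Obs d) × Cov d => ‖(p.1 i).1 - p.2‖ := by
    intro i; fun_prop
  refine measurable_to_countable' fun σ => ?_
  have hset : (fun p : (Fin n → Obs d) × Cov d => neighbour p.1 p.2) ⁻¹' {σ} =
      {p | (∀ i j : Fin n, i ≤ j → ‖(p.1 (σ i)).1 - p.2‖ ≤ ‖(p.1 (σ j)).1 - p.2‖) ∧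
        ∀ i j : Fin n, i < j → ‖(p.1 (σ i)).1 - p.2‖ = ‖(p.1 (σ j)).1 - p.2‖ → σ i < σ j} := by
    ext p
    simp only [Set.mem_preimage, Set.mem_singleton_iff, neighbour, Set.mem_ofPred_eq]
    rw [eq_comm, Tuple.eq_sort_iff]
    rfl
  rw [hset]
  refine MeasurableSet.inter (measurableSet_setOfPred.2 ?_) (measurableSet_setOfPred.2 ?_)
  · exact Measurable.forall fun i => Measurable.forall fun j => measurable_const.imp
      (measurableSet_setOfPred.1 (measurableSet_le (hdist _) (hdist _)))
  · exact Measurable.forall fun i => Measurable.forall fun j => measurable_const.imp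
      ((measurableSet_setOfPred.1 (measurableSet_eq_fun (hdist _) (hdist _))).imp measurable_const)

/-- A measurable function of the `i`-th nearest observation is measurable in sample and point. -/
lemma measurable_comp_neighbour {d n : ℕ} {G : Obs d → ℝ} (hG : Measurable G) (i : Fin n) :
    Measurable fun p : (Fin n → Obs d) × Cov d => G (p.1 (neighbour p.1 p.2 i)) := by
  have h1 : Measurable fun q : Equiv.Perm (Fin n) × ((Fin n → Obs d) × Cov d) =>
      G (q.2.1 (q.1 i)) :=
    measurable_from_prod_countable_right fun σ =>
      hG.comp ((measurable_pi_apply (σ i)).comp measurable_fst)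
  exact h1.comp ((measurable_neighbour d n).prodMk measurable_id)

/-- Sums of a measurable function over the `k` nearest observations. -/
noncomputable def neighbourSum {d n : ℕ} (G : Obs d → ℝ) (k : ℕ) (z : Fin n → Obs d) (x : Cov d) : ℝ :=
  ∑ i : Fin n, if (i : ℕ) < k then G (z (neighbour z x i)) else 0

lemma measurable_neighbourSum {d n : ℕ} {G : Obs d → ℝ} (hG : Measurable G) (k : ℕ) :
    Measurable fun p : (Fin n → Obs d) × Cov d => neighbourSum G k p.1 p.2 := by
  refine Finset.measurable_sum _ fun i _ => ?_
  split_ifs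
  · exact measurable_comp_neighbour hG i
  · exact measurable_const

/-- The label of an observation as a real number. -/
noncomputable def label {d : ℕ} (o : Obs d) : ℝ := if o.2 = true then 1 else 0

lemma measurable_label {d : ℕ} : Measurable (label : Obs d → ℝ) :=
  Measurable.ite (measurable_snd (measurableSet_singleton true)) measurable_const measurable_const

lemma knnEst_eq {d n : ℕ} (k : ℕ) (z : Fin n → Obs d) (x : Cov d) :
    knnEst k z x = 1 / (k : ℝ) * neighbourSum label k z x := rfl

lemma measurable_knnEst {d n : ℕ} (k : ℕ) :
    Measurable fun p : (Fin n → Obs d) × Cov d => knnEst k p.1 p.2 :=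
  (measurable_neighbourSum measurable_label k).const_mul _

lemma measurable_decide_half_le {Z : Type*} [MeasurableSpace Z] {g : Z → ℝ} (hg : Measurable g) :
    Measurable fun z => decide (1 / 2 ≤ g z) :=
  measurable_to_bool (by
    have : (fun z => decide (1 / 2 ≤ g z)) ⁻¹' {true} = {z | 1 / 2 ≤ g z} := by ext z; simp
    rw [this]
    exact measurableSet_le measurable_const hg)

lemma measurable_adaptiveK (d n : ℕ) :
    Measurable fun p : (Fin n → Obs d) × Cov d => adaptiveK p.1 p.2 := by
  set A : (Fin n → Obs d) × Cov d → Set ℕ := fun p => {k : ℕ | 1 ≤ k ∧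
    (√(((d : ℝ) + Real.log n) * Real.log n) < √(k : ℝ) * |knnEst k p.1 p.2 - 1 / 2| ∨ k = n)}
  have hmem : ∀ k, MeasurableSet {p | k ∈ A p} := by
    intro k
    have hk : Measurable fun p : (Fin n → Obs d) × Cov d => √(k : ℝ) * |knnEst k p.1 p.2 - 1 / 2| := by
      have := measurable_knnEst (d := d) (n := n) k
      fun_prop
    exact measurableSet_setOfPred.2 (measurable_const.and
      ((measurableSet_setOfPred.1 (measurableSet_lt measurable_const hk)).or measurable_const))
  refine measurable_of_Iic fun m => ?_
  -- `sInf ∅ = 0`, so the event also contains the points where no `k` qualifies.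
  have hset : (fun p : (Fin n → Obs d) × Cov d => adaptiveK p.1 p.2) ⁻¹' Set.Iic m =
      (⋃ k ∈ Set.Iic m, {p | k ∈ A p}) ∪ ⋂ k, {p | k ∈ A p}ᶜ := by
    ext p
    simp only [Set.mem_preimage, Set.mem_Iic, Set.mem_union, Set.mem_iUnion, Set.mem_iInter,
      Set.mem_compl_iff, Set.mem_ofPred_eq, exists_prop]
    change sInf (A p) ≤ m ↔ _
    constructor
    · intro h
      by_cases hne : (A p).Nonempty
      · exact Or.inl ⟨_, h, Nat.sInf_mem hne⟩
      · exact Or.inr fun k hk => hne ⟨k, hk⟩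
    · rintro (⟨k, hk, hkA⟩ | h)
      · exact (Nat.sInf_le hkA).trans hk
      · rw [Set.eq_empty_iff_forall_notMem.2 h]; simp
  rw [hset]
  exact (MeasurableSet.biUnion (Set.to_countable _) fun k _ => hmem k).union
    (MeasurableSet.iInter fun k => (hmem k).compl)

lemma measurable_adaptiveClassifier (d n : ℕ) :
    Measurable fun p : (Fin n → Obs d) × Cov d => adaptiveClassifier p.1 p.2 := by
  refine measurable_decide_half_le ?_
  have h1 : Measurable fun q : ℕ × ((Fin n → Obs d) × Cov d) => knnEst q.1 q.2.1 q.2.2 :=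
    measurable_from_prod_countable_right fun k => measurable_knnEst k
  exact h1.comp ((measurable_adaptiveK d n).prodMk measurable_id)

lemma sourceClassifier_eq {d n : ℕ} {wP : ℝ} (wQ : ℝ) (hwP : 0 < wP) {k : ℕ} (hk : 1 ≤ k)
    (z : Fin n → Obs d) (x : Cov d) :
    sourceClassifier wP wQ k z x = decide (1 / 2 ≤ knnEst k z x) := by
  have hk' : (0 : ℝ) < k := by exact_mod_cast hk
  have : (wP * k * knnEst k z x) / (wP * k) = knnEst k z x := by field_simp
  simp only [sourceClassifier, weightedClassifier, weightedEst, Nat.cast_zero, mul_zero, zero_mul,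
    add_zero, this]

/-! ### Labels as independent coin flips given the covariates -/

instance covLaw_isProbabilityMeasure {d : ℕ} (P : ProbabilityMeasure (Obs d)) :
    IsProbabilityMeasure (covLaw P) := by
  unfold covLaw; infer_instance

/-- Attach to a covariate `x` the label `1{u < η x}`; when `u` is uniform on `[0, 1]`, the label
is `1` with probability `η x`. -/
noncomputable def attachLabel {d : ℕ} (η : Cov d → ℝ) (p : Cov d × unitInterval) : Obs d :=
  (p.1, decide ((p.2 : ℝ) < η p.1))

lemma measurable_attachLabel {d : ℕ} {η : Cov d → ℝ} (hη : Measurable η) :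
    Measurable (attachLabel η) := by
  refine measurable_fst.prodMk (measurable_to_bool ?_)
  have : (fun p : Cov d × unitInterval => decide ((p.2 : ℝ) < η p.1)) ⁻¹' {true} =
      {p | (p.2 : ℝ) < η p.1} := by ext p; simp
  rw [this]
  exact measurableSet_lt (by fun_prop) (by fun_prop)

/-- Two probability measures on `Bool` agree as soon as they give `true` the same mass. -/
lemma bool_measure_ext {μ ν : Measure Bool} [IsProbabilityMeasure μ] [IsProbabilityMeasure ν]
    (h : μ.real {true} = ν.real {true}) : μ = ν := by
  have ht : μ {true} = ν {true} := (measureReal_eq_measureReal_iff).1 h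
  refine Measure.ext_of_singleton fun b => ?_
  cases b
  · have : ({false} : Set Bool) = {true}ᶜ := by ext b; cases b <;> simp
    rw [this, prob_compl_eq_one_sub (measurableSet_singleton _),
      prob_compl_eq_one_sub (measurableSet_singleton _), ht]
  · exact ht

lemma volume_unitInterval_lt {a : ℝ} (ha : a ∈ Set.Icc (0 : ℝ) 1) :
    (volume : Measure unitInterval) {u | (u : ℝ) < a} = ENNReal.ofReal a :=
  unitInterval.volume_Iio (x := ⟨a, ha⟩)

lemma map_attachLabel {d : ℕ} {P : ProbabilityMeasure (Obs d)} {η : Cov d → ℝ}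
    (hη : IsRegressionFunction P η) :
    ((covLaw P).prod (volume : Measure unitInterval)).map (attachLabel η) = P := by
  have hm := measurable_attachLabel hη.measurable
  ext S hS
  rw [Measure.map_apply hm hS, Measure.prod_apply (hm hS)]
  conv_rhs => rw [← (P : Measure (Obs d)).disintegrate (P : Measure (Obs d)).condKernel]
  rw [Measure.compProd_apply hS]
  refine lintegral_congr_ae ?_
  filter_upwards [hη.ae_eq] with x hx
  have hmx : Measurable fun u : unitInterval => decide ((u : ℝ) < η x) :=
    measurable_snd.comp (hm.comp measurable_prodMk_left)
  have : IsProbabilityMeasure ((volume : Measure unitInterval).map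
      fun u : unitInterval => decide ((u : ℝ) < η x)) :=
    Measure.isProbabilityMeasure_map hmx.aemeasurable
  have heq : (volume : Measure unitInterval).map (fun u : unitInterval => decide ((u : ℝ) < η x)) =
      (P : Measure (Obs d)).condKernel x := by
    refine bool_measure_ext ?_
    rw [map_measureReal_apply hmx (measurableSet_singleton _)]
    have hset : (fun u : unitInterval => decide ((u : ℝ) < η x)) ⁻¹' {true} =
      {u : unitInterval | (u : ℝ) < η x} := by ext p; simp
    rw [hset, measureReal_def, volume_unitInterval_lt (hη.mem_Icc x),
      ENNReal.toReal_ofReal (hη.mem_Icc x).1, hx]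
    rfl
  rw [← heq, Measure.map_apply hmx (measurable_prodMk_left hS)]
  rfl

/-- Attach labels to a whole sample of covariates. -/
noncomputable def attachLabels {d n : ℕ} (η : Cov d → ℝ)
    (q : (Fin n → Cov d) × (Fin n → unitInterval)) : Fin n → Obs d :=
  fun i => attachLabel η (q.1 i, q.2 i)

lemma measurable_attachLabels {d n : ℕ} {η : Cov d → ℝ} (hη : Measurable η) :
    Measurable (attachLabels (n := n) η) :=
  measurable_pi_lambda _ fun i => (measurable_attachLabel hη).comp (by fun_prop)

/-- An i.i.d. sample from `P` arises from i.i.d. covariates by independent labelling. -/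
lemma map_attachLabels {d n : ℕ} {P : ProbabilityMeasure (Obs d)} {η : Cov d → ℝ}
    (hη : IsRegressionFunction P η) :
    ((Measure.pi fun _ : Fin n => covLaw P).prod
      (Measure.pi fun _ : Fin n => (volume : Measure unitInterval))).map (attachLabels η) =
      Measure.pi fun _ : Fin n => (P : Measure (Obs d)) := by
  have h1 := (measurePreserving_arrowProdEquivProdArrow (Cov d) unitInterval (Fin n)
    (fun _ => covLaw P) (fun _ => volume)).symm _
  have h2 := Measure.pi_map_pi (μ := fun _ : Fin n => (covLaw P).prod (volume : Measure unitInterval))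
    (f := fun _ => attachLabel η) (fun _ => (measurable_attachLabel hη.measurable).aemeasurable)
  simp only [map_attachLabel hη] at h2
  rw [← h2, ← h1.map_eq, Measure.map_map ?_ (MeasurableEquiv.measurable _)]
  · rfl
  · exact measurable_pi_lambda _ fun i =>
      (measurable_attachLabel hη.measurable).comp (measurable_pi_apply i)

/-! ### Hoeffding's inequality for the labels of the nearest neighbours -/

/-- Hoeffding's inequality for independent labels with fixed covariates. -/
lemma measure_label_deviation {d n : ℕ} {η : Cov d → ℝ} (hη : ∀ x, η x ∈ Set.Icc (0 : ℝ) 1)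
    (xs : Fin n → Cov d) (T : Finset (Fin n)) {s : ℝ} (hs : s = 1 ∨ s = -1) {ε : ℝ} (hε : 0 ≤ ε) :
    (Measure.pi fun _ : Fin n => (volume : Measure unitInterval)).real
      {u | ε ≤ ∑ i ∈ T, -s * (label (attachLabel η (xs i, u i)) - η (xs i))} ≤
      Real.exp (-(2 * ε ^ 2 / T.card)) := by
  have hlab : ∀ i, (fun u : unitInterval => label (attachLabel η (xs i, u))) =
      Set.indicator {u : unitInterval | (u : ℝ) < η (xs i)} 1 := by
    intro i; ext u
    simp [label, attachLabel, Set.indicator_apply]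
  have hms : ∀ i, MeasurableSet {u : unitInterval | (u : ℝ) < η (xs i)} := fun i =>
    measurableSet_lt (by fun_prop) measurable_const
  set X : Fin n → unitInterval → ℝ := fun i u => -s * label (attachLabel η (xs i, u))
  have hXm : ∀ i, Measurable (X i) := by
    intro i
    refine Measurable.const_mul ?_ _
    rw [hlab i]; exact measurable_one.indicator (hms i)
  have hint : ∀ i, ∫ u, X i u = -s * η (xs i) := by
    intro i
    simp only [X]
    rw [integral_const_mul, hlab i, integral_indicator_one (hms i), measureReal_def,
      volume_unitInterval_lt (hη _), ENNReal.toReal_ofReal (hη _).1]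
  have hsub : ∀ i, HasSubgaussianMGF (fun u => X i u - ∫ u, X i u) ((1 / 2 : NNReal) ^ 2) volume := by
    intro i
    have hl : ∀ u, label (attachLabel η (xs i, u)) = 0 ∨ label (attachLabel η (xs i, u)) = 1 := by
      intro u; unfold label; split_ifs <;> simp
    rcases hs with rfl | rfl
    · have := hasSubgaussianMGF_of_mem_Icc (X := X i) (μ := volume) (a := -1) (b := 0)
        (hXm i).aemeasurable (Eventually.of_forall fun u => by
          rcases hl u with h | h <;> simp [X, h])
      simpa using this
    · have := hasSubgaussianMGF_of_mem_Icc (X := X i) (μ := volume) (a := 0) (b := 1)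
        (hXm i).aemeasurable (Eventually.of_forall fun u => by
          rcases hl u with h | h <;> simp [X, h])
      simpa using this
  have hindep : iIndepFun (fun i (u : Fin n → unitInterval) => X i (u i) - ∫ v, X i v)
      (Measure.pi fun _ : Fin n => (volume : Measure unitInterval)) :=
    iIndepFun_pi (X := fun i u => X i u - ∫ v, X i v)
      (fun i => ((hXm i).sub_const _).aemeasurable)
  have hsub' : ∀ i ∈ T, HasSubgaussianMGF (fun (u : Fin n → unitInterval) => X i (u i) - ∫ v, X i v)
      ((1 / 2 : NNReal) ^ 2) (Measure.pi fun _ : Fin n => (volume : Measure unitInterval)) := by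
    intro i _
    have hmp := measurePreserving_eval (fun _ : Fin n => (volume : Measure unitInterval)) i
    refine HasSubgaussianMGF.of_map (X := fun u => X i u - ∫ v, X i v) (Y := Function.eval i)
      hmp.measurable.aemeasurable ?_
    rw [hmp.map_eq]; exact hsub i
  have := HasSubgaussianMGF.measure_sum_ge_le_of_iIndepFun hindep hsub' hε
  convert this using 2
  · congr 1; ext u
    simp only [hint, X, mul_sub]
  · simp only [Finset.sum_const, nsmul_eq_mul]
    push_cast
    ring

lemma neighbourSum_eq_sum_map {d n : ℕ} (G : Obs d → ℝ) (k : ℕ) (z : Fin n → Obs d) (x : Cov d) :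
    neighbourSum G k z x =
      ∑ j ∈ (Finset.univ.filter fun i : Fin n => (i : ℕ) < k).map (neighbour z x).toEmbedding,
        G (z j) := by
  rw [neighbourSum, Finset.sum_map, Finset.sum_filter]
  rfl

/-- Conditionally on the covariates, the sum of the `k` nearest labels deviates from its
conditional mean in a given direction with sub-Gaussian probability. -/
lemma measure_neighbourSum_deviation {d : ℕ} (n : ℕ) {P : ProbabilityMeasure (Obs d)}
    {η : Cov d → ℝ} (hη : IsRegressionFunction P η) (x : Cov d) {k : ℕ} {s : ℝ}
    (hs : s = 1 ∨ s = -1) {ε : ℝ} (hε : 0 ≤ ε) (hkn : k ≤ n) :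
    (Measure.pi fun _ : Fin n => (P : Measure (Obs d)))
      {z | s * neighbourSum (fun o => label o - η o.1) k z x ≤ -ε} ≤
      ENNReal.ofReal (Real.exp (-(2 * ε ^ 2 / k))) := by
  have hm : MeasurableSet {z : Fin n → Obs d |
      s * neighbourSum (fun o => label o - η o.1) k z x ≤ -ε} := by
    have h1 := (measurable_neighbourSum (n := n)
      (measurable_label.sub (hη.measurable.comp (measurable_fst (α := Cov d) (β := Bool)))) k).comp
      (measurable_prodMk_right (y := x))
    exact measurableSet_le (h1.const_mul s) measurable_const
  rw [← map_attachLabels hη, Measure.map_apply (measurable_attachLabels hη.measurable) hm,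
    Measure.prod_apply (measurable_attachLabels hη.measurable hm)]
  have : ∀ xs : Fin n → Cov d, (Measure.pi fun _ : Fin n => (volume : Measure unitInterval))
      (Prod.mk xs ⁻¹' (attachLabels η ⁻¹' {z : Fin n → Obs d |
        s * neighbourSum (fun o => label o - η o.1) k z x ≤ -ε})) ≤
      ENNReal.ofReal (Real.exp (-(2 * ε ^ 2 / k))) := by
    intro xs
    set σ := Tuple.sort fun i => ‖xs i - x‖
    set T := (Finset.univ.filter fun i : Fin n => (i : ℕ) < k).map σ.toEmbedding
    have hT : T.card = k := by
      rw [Finset.card_map, Fin.card_filter_val_lt, min_eq_right hkn]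
    rw [← ofReal_measureReal]
    refine ENNReal.ofReal_le_ofReal ?_
    have hdev := measure_label_deviation hη.mem_Icc xs T hs hε
    rw [hT] at hdev
    refine le_trans (measureReal_mono ?_) hdev
    intro u hu
    simp only [Set.mem_preimage, Set.mem_ofPred_eq] at hu ⊢
    rw [neighbourSum_eq_sum_map] at hu
    rw [← Finset.mul_sum]
    have : ∑ i ∈ T, (label (attachLabel η (xs i, u i)) - η (xs i)) =
      ∑ j ∈ (Finset.univ.filter fun i : Fin n => (i : ℕ) < k).map
        (neighbour (attachLabels η (xs, u)) x).toEmbedding,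
        (label (attachLabels η (xs, u) j) - η (attachLabels η (xs, u) j).1) := rfl
    rw [this]; linarith
  calc _ ≤ ∫⁻ _, ENNReal.ofReal (Real.exp (-(2 * ε ^ 2 / k)))
        ∂(Measure.pi fun _ : Fin n => covLaw P) := lintegral_mono this
    _ = _ := by simp

/-! ### The number of sample points in a ball -/

open scoped Classical in
/-- The number of covariates of the sample that lie in `B`. -/
noncomputable def hitCount {d n : ℕ} (B : Set (Cov d)) (z : Fin n → Obs d) : ℕ :=
  (Finset.univ.filter fun i : Fin n => (z i).1 ∈ B).card

/-- Multiplicative Chernoff bound: a set of mass at least `p` contains at least half of the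
expected number `n * p` of sample points, up to an exponentially small probability. An additive
bound would not do, as `p` tends to zero with `n`. -/
lemma measure_hitCount_lt {d n : ℕ} (P : ProbabilityMeasure (Obs d)) {B : Set (Cov d)}
    (hB : MeasurableSet B) {p : ℝ} (hp : p ≤ (covLaw P).real B) {k : ℕ}
    (hk : 2 * (k : ℝ) ≤ n * p) :
    (Measure.pi fun _ : Fin n => (P : Measure (Obs d))) {z | hitCount B z < k} ≤
      ENNReal.ofReal (Real.exp (-(n * p / 8))) := by
  classical
  set q := (covLaw P).real B
  set f : Obs d → ℝ := fun o => if o.1 ∈ B then Real.exp (-1) else 1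
  have hS : MeasurableSet {o : Obs d | o.1 ∈ B} := measurable_fst hB
  have hq : (P : Measure (Obs d)).real {o | o.1 ∈ B} = q := by
    simp only [q, covLaw, Measure.fst]
    rw [map_measureReal_apply measurable_fst hB]; rfl
  have hfm : Measurable f := Measurable.ite hS measurable_const measurable_const
  have hf0 : ∀ o, 0 < f o := by intro o; simp only [f]; split_ifs <;> positivity
  have hf1 : ∀ o, f o ≤ 1 := by
    intro o; simp only [f]; split_ifs
    · exact Real.exp_le_one_iff.2 (by norm_num)
    · exact le_rfl
  have hfint : ∫ o, f o ∂(P : Measure (Obs d)) = 1 - q * (1 - Real.exp (-1)) := by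
    have hfe : f = fun o => 1 - Set.indicator {o : Obs d | o.1 ∈ B} (fun _ => 1 - Real.exp (-1)) o := by
      ext o; simp only [f, Set.indicator_apply, Set.mem_ofPred_eq]; split_ifs <;> ring
    rw [hfe, integral_sub (integrable_const _) ((integrable_const _).indicator hS),
      integral_indicator_const _ hS, hq]
    simp
  have hprod : ∫ z, ∏ i, f (z i) ∂(Measure.pi fun _ : Fin n => (P : Measure (Obs d))) =
      (1 - q * (1 - Real.exp (-1))) ^ n := by
    rw [integral_fintype_prod_eq_prod (f := fun _ : Fin n => f)]
    simp [hfint]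
  have hpi : ∀ z : Fin n → Obs d, ∏ i, f (z i) = Real.exp (-(hitCount B z : ℝ)) := by
    intro z
    simp only [f, Finset.prod_ite, Finset.prod_const_one, mul_one, Finset.prod_const, hitCount]
    rw [← Real.exp_nat_mul]; congr 1; simp
  have hmark := mul_meas_ge_le_integral_of_nonneg
    (μ := Measure.pi fun _ : Fin n => (P : Measure (Obs d)))
    (f := fun z => ∏ i, f (z i)) (Eventually.of_forall fun z => Finset.prod_nonneg fun i _ => (hf0 _).le)
    (Integrable.of_mem_Icc 0 1 (by
        exact (Finset.measurable_prod _ fun i _ => hfm.comp (measurable_pi_apply i)).aemeasurable)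
      (Eventually.of_forall fun z => ⟨Finset.prod_nonneg fun i _ => (hf0 _).le,
        Finset.prod_le_one (fun i _ => (hf0 _).le) fun i _ => hf1 _⟩)) (Real.exp (-(n * p / 2)))
  rw [hprod] at hmark
  have he : Real.exp (-1) ≤ 3 / 8 := by
    rw [Real.exp_neg, inv_le_comm₀ (Real.exp_pos _) (by norm_num)]
    have := Real.exp_one_gt_d9
    norm_num; linarith
  have hq1 : q ≤ 1 := measureReal_le_one
  have hq0 : 0 ≤ q := measureReal_nonneg
  have hpow : (1 - q * (1 - Real.exp (-1))) ^ n ≤ Real.exp (-(5 / 8 * (n * p))) := by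
    have h1 : 1 - q * (1 - Real.exp (-1)) ≤ Real.exp (-(q * (1 - Real.exp (-1)))) := by
      have := Real.add_one_le_exp (-(q * (1 - Real.exp (-1))))
      linarith
    have h0 : 0 ≤ 1 - q * (1 - Real.exp (-1)) := by
      have := Real.exp_pos (-1)
      nlinarith
    calc _ ≤ (Real.exp (-(q * (1 - Real.exp (-1))))) ^ n := pow_le_pow_left₀ h0 h1 n
      _ = Real.exp (-(n * (q * (1 - Real.exp (-1))))) := by rw [← Real.exp_nat_mul]; congr 1; ring
      _ ≤ _ := by
        refine Real.exp_le_exp.2 (neg_le_neg ?_)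
        have h2 : q * (5 / 8) ≤ q * (1 - Real.exp (-1)) :=
          mul_le_mul_of_nonneg_left (by linarith) hq0
        have hn : (0 : ℝ) ≤ n := Nat.cast_nonneg n
        nlinarith [mul_le_mul_of_nonneg_left hp hn, mul_le_mul_of_nonneg_left h2 hn]
  rw [← ofReal_measureReal]
  refine ENNReal.ofReal_le_ofReal ?_
  have hmono : (Measure.pi fun _ : Fin n => (P : Measure (Obs d))).real {z | hitCount B z < k} ≤
      (Measure.pi fun _ : Fin n => (P : Measure (Obs d))).real
        {z | Real.exp (-(n * p / 2)) ≤ ∏ i, f (z i)} := by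
    refine measureReal_mono fun z hz => ?_
    simp only [Set.mem_ofPred_eq] at hz ⊢
    rw [hpi z]
    have : (hitCount B z : ℝ) ≤ k := by exact_mod_cast hz.le
    exact Real.exp_le_exp.2 (by linarith)
  refine hmono.trans ?_
  have h3 := hmark.trans hpow
  rw [show Real.exp (-(5 / 8 * (n * p))) = Real.exp (-(n * p / 2)) * Real.exp (-(n * p / 8)) by
    rw [← Real.exp_add]; congr 1; ring] at h3
  exact le_of_mul_le_mul_left h3 (Real.exp_pos _)

lemma hitCount_le {d n : ℕ} (B : Set (Cov d)) (z : Fin n → Obs d) : hitCount B z ≤ n := by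
  classical
  exact (Finset.card_le_univ _).trans (by simp)

/-- If a ball around `x` contains `k` covariates, then it contains the `k` nearest ones. -/
lemma neighbour_mem_ball {d n : ℕ} {z : Fin n → Obs d} {x : Cov d} {r : ℝ} {i : Fin n}
    (hi : (i : ℕ) < hitCount (Metric.ball x r) z) :
    ‖(z (neighbour z x i)).1 - x‖ < r := by
  classical
  set g : Fin n → ℝ := fun j => ‖(z j).1 - x‖
  have hcard : hitCount (Metric.ball x r) z =
      (Finset.univ.filter fun j : Fin n => (g ∘ Tuple.sort g) j < r).card := by
    unfold hitCount
    refine (Finset.card_bij (fun j _ => Tuple.sort g j) ?_ ?_ ?_).symm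
    · intro j hj
      simpa [g, dist_eq_norm] using hj
    · intro a _ b _ h; exact (Tuple.sort g).injective h
    · intro j hj
      exact ⟨(Tuple.sort g).symm j, by simpa [g, dist_eq_norm] using hj, by simp⟩
  rw [hcard] at hi
  exact (Tuple.lt_card_lt_iff_apply_lt_of_monotone (Tuple.monotone_sort g)).1 hi

/-! ### Mass of small balls -/

/-- The Lebesgue measure of the Euclidean unit ball. -/
noncomputable def unitBallVol (d : ℕ) : ℝ := (volume : Measure (Cov d)).real (Metric.ball 0 1)

lemma unitBallVol_pos (d : ℕ) : 0 < unitBallVol d :=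
  ENNReal.toReal_pos (Metric.measure_ball_pos _ _ one_pos).ne' measure_ball_lt_top.ne

lemma ball_mass_lower {d : ℕ} (hd : 1 ≤ d) {θ : Params} (hθ : θ.Admissible)
    {P Q : ProbabilityMeasure (Obs d)} {Ω : Set (Cov d)}
    (h : CommonSupportStrongDensity θ P Q Ω) {x : Cov d} (hx : x ∈ Ω) {r : ℝ} (hr : 0 < r)
    (hr' : r < θ.rLam) :
    θ.cLam ^ 2 * unitBallVol d * r ^ d ≤ (covLaw P).real (Metric.ball x r) := by
  have : NeZero d := ⟨by omega⟩
  have hΩ : MeasurableSet Ω := h.support_P ▸ Measure.isClosed_support.measurableSet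
  obtain ⟨p, hpm, hP, hpb⟩ := h.density_P
  have hc := hθ.cLam_pos
  have h1 : ENNReal.ofReal (θ.cLam ^ 2 * unitBallVol d * r ^ d) ≤ covLaw P (Metric.ball x r) := by
    calc ENNReal.ofReal (θ.cLam ^ 2 * unitBallVol d * r ^ d)
        = ENNReal.ofReal θ.cLam * (ENNReal.ofReal θ.cLam * volume (Metric.ball x r)) := by
          rw [Measure.addHaar_ball volume x hr.le, finrank_euclideanSpace_fin, unitBallVol,
            show θ.cLam ^ 2 * (volume : Measure (Cov d)).real (Metric.ball 0 1) * r ^ d =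
              θ.cLam * (θ.cLam * (r ^ d * (volume : Measure (Cov d)).real (Metric.ball 0 1))) by ring,
            ENNReal.ofReal_mul hc.le, ENNReal.ofReal_mul hc.le, ENNReal.ofReal_mul (by positivity),
            ofReal_measureReal measure_ball_lt_top.ne]
      _ ≤ ENNReal.ofReal θ.cLam * volume (Ω ∩ Metric.ball x r) := by
          gcongr; exact h.regular x hx r hr hr'
      _ = ∫⁻ _ in Ω ∩ Metric.ball x r, ENNReal.ofReal θ.cLam := by simp
      _ ≤ ∫⁻ y in Ω ∩ Metric.ball x r, ENNReal.ofReal (p y) :=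
          setLIntegral_mono (by fun_prop) fun y hy => ENNReal.ofReal_le_ofReal (hpb y hy.1).1.le
      _ = covLaw P (Ω ∩ Metric.ball x r) := by
          rw [hP, withDensity_apply _ (hΩ.inter Metric.isOpen_ball.measurableSet)]
      _ ≤ _ := measure_mono Set.inter_subset_right
  rw [measureReal_def]
  exact (ENNReal.ofReal_le_iff_le_toReal (measure_ne_top _ _)).1 h1

lemma ae_mem_support {d : ℕ} {P : ProbabilityMeasure (Obs d)} {Ω : Set (Cov d)}
    (h : (covLaw P).support = Ω) : ∀ᵐ x ∂covLaw P, x ∈ Ω := by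
  rw [← h]; exact Measure.support_mem_ae

lemma ae_sample_mem_support {d : ℕ} (n : ℕ) {P : ProbabilityMeasure (Obs d)} {Ω : Set (Cov d)}
    (h : (covLaw P).support = Ω) :
    ∀ᵐ z ∂(Measure.pi fun _ : Fin n => (P : Measure (Obs d))), ∀ i, (z i).1 ∈ Ω := by
  rw [ae_all_iff]
  intro i
  have h1 : ∀ᵐ o ∂(P : Measure (Obs d)), o.1 ∈ Ω :=
    ae_of_ae_map measurable_fst.aemeasurable (ae_mem_support h)
  exact (measurePreserving_eval (fun _ : Fin n => (P : Measure (Obs d))) i).quasiMeasurePreserving.ae h1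

/-! ### Misclassification at a given point -/

/-- Near a point `x` where `ηQ` is away from `1/2`, the source regression function `ηP` lies on
the same side of `1/2` as `ηQ x`, at a distance of order `|ηQ x - 1/2| ^ γ`. The radius for which
this holds is of order `|ηQ x - 1/2| ^ (1/b)`; the exponent `b` plays the role of the
smoothness. The sign `s` is that of `ηQ x - 1/2`. -/
def LocalMargin {d : ℕ} (ηP ηQ : Cov d → ℝ) (Ω : Set (Cov d)) (γ b c₁ c₂ : ℝ) : Prop :=
  ∀ x ∈ Ω, ∀ x' ∈ Ω, ∀ s : ℝ, s = 1 ∨ s = -1 → 0 < s * (ηQ x - 1 / 2) →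
    ‖x' - x‖ < c₂ * (s * (ηQ x - 1 / 2)) ^ (1 / b) →
    c₁ * (s * (ηQ x - 1 / 2)) ^ γ ≤ s * (ηP x' - 1 / 2)

lemma neighbourSum_lower {d n : ℕ} {G : Obs d → ℝ} {m : ℝ} {k : ℕ} (hk : k ≤ n)
    {z : Fin n → Obs d} {x : Cov d} {s : ℝ}
    (h : ∀ i : Fin n, (i : ℕ) < k → m ≤ s * G (z (neighbour z x i))) :
    k * m ≤ s * neighbourSum G k z x := by
  have h1 : ∑ i : Fin n, (if (i : ℕ) < k then m else 0) = k * m := by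
    rw [← Finset.sum_filter, Finset.sum_const, Fin.card_filter_val_lt, min_eq_right hk, nsmul_eq_mul]
  rw [← h1, neighbourSum, Finset.mul_sum]
  refine Finset.sum_le_sum fun i _ => ?_
  split_ifs with hi
  · exact h i hi
  · simp

lemma neighbourSum_label {d n : ℕ} (η : Cov d → ℝ) {k : ℕ} (hk : k ≤ n)
    (z : Fin n → Obs d) (x : Cov d) :
    neighbourSum label k z x = neighbourSum (fun o => label o - η o.1) k z x +
      neighbourSum (fun o => η o.1 - 1 / 2) k z x + k / 2 := by
  have h1 : ∑ i : Fin n, (if (i : ℕ) < k then (1 / 2 : ℝ) else 0) = k / 2 := by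
    rw [← Finset.sum_filter, Finset.sum_const, Fin.card_filter_val_lt, min_eq_right hk, nsmul_eq_mul]
    ring
  rw [← h1]
  simp only [neighbourSum, ← Finset.sum_add_distrib]
  refine Finset.sum_congr rfl fun i _ => ?_
  split_ifs <;> ring

/-- Bias and fluctuation: the `k`-nearest-neighbour estimate is on the correct side of `1/2`, up
to the deviation `ε / k` of the labels. -/
lemma signed_knnEst_lower {d n : ℕ} {η : Cov d → ℝ} {m ε r : ℝ} {k : ℕ} (hk : 1 ≤ k)
    {z : Fin n → Obs d} {x : Cov d} {s : ℝ} (hkc : k ≤ hitCount (Metric.ball x r) z)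
    (hm : ∀ i, ‖(z i).1 - x‖ < r → m ≤ s * (η (z i).1 - 1 / 2))
    (hdev : -ε < s * neighbourSum (fun o => label o - η o.1) k z x) :
    m - ε / k < s * (knnEst k z x - 1 / 2) := by
  have hkn : k ≤ n := hkc.trans (hitCount_le _ _)
  have hk0 : (0 : ℝ) < k := by exact_mod_cast hk
  have h1 : k * m ≤ s * neighbourSum (fun o => η o.1 - 1 / 2) k z x :=
    neighbourSum_lower hkn fun i hi => hm _ (neighbour_mem_ball (hi.trans_le hkc))
  have h2 : s * (knnEst k z x - 1 / 2) = (s * neighbourSum (fun o => label o - η o.1) k z x +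
      s * neighbourSum (fun o => η o.1 - 1 / 2) k z x) / k := by
    rw [knnEst_eq, neighbourSum_label η hkn, eq_div_iff hk0.ne']
    have hinv : 1 / (k : ℝ) * k = 1 := one_div_mul_cancel hk0.ne'
    linear_combination (s * neighbourSum (fun o => label o - η o.1) k z x +
      s * neighbourSum (fun o => η o.1 - 1 / 2) k z x + s * k / 2) * hinv
  rw [h2, lt_div_iff₀ hk0, sub_mul, div_mul_cancel₀ _ hk0.ne']
  linarith

lemma decide_half_le_eq {s u v : ℝ} (hs : s = 1 ∨ s = -1) (hu : 0 < s * (u - 1 / 2))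
    (hv : 0 < s * (v - 1 / 2)) : decide (1 / 2 ≤ u) = decide (1 / 2 ≤ v) := by
  rcases hs with rfl | rfl
  · rw [decide_eq_true (by linarith), decide_eq_true (by linarith)]
  · rw [decide_eq_false (by linarith), decide_eq_false (by linarith)]

lemma measure_knn_error {d n : ℕ} {P : ProbabilityMeasure (Obs d)} {ηP : Cov d → ℝ}
    (hη : IsRegressionFunction P ηP) {Ω : Set (Cov d)} (hΩ : (covLaw P).support = Ω) {x : Cov d}
    {s m r p : ℝ} (hs : s = 1 ∨ s = -1) (hm0 : 0 ≤ m)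
    (hm : ∀ x' ∈ Ω, ‖x' - x‖ < r → m ≤ s * (ηP x' - 1 / 2))
    (hp : p ≤ (covLaw P).real (Metric.ball x r)) {k : ℕ} (hk : 1 ≤ k) (hkp : 2 * (k : ℝ) ≤ n * p)
    {v : ℝ} (hv : 0 < s * (v - 1 / 2)) :
    (Measure.pi fun _ : Fin n => (P : Measure (Obs d)))
      {z | decide (1 / 2 ≤ knnEst k z x) ≠ decide (1 / 2 ≤ v)} ≤
      ENNReal.ofReal (Real.exp (-(n * p / 8))) + ENNReal.ofReal (Real.exp (-(2 * k * m ^ 2))) := by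
  have hk0 : (0 : ℝ) < k := by exact_mod_cast hk
  have hkn : k ≤ n := by
    have : p ≤ 1 := hp.trans measureReal_le_one
    have hn : (0 : ℝ) ≤ n := Nat.cast_nonneg n
    have : (k : ℝ) ≤ n := by nlinarith
    exact_mod_cast this
  have hdev := measure_neighbourSum_deviation n hη x (k := k) hs (ε := k * m) (by positivity) hkn
  rw [show 2 * (k * m) ^ 2 / (k : ℝ) = 2 * k * m ^ 2 by field_simp] at hdev
  have hcount := measure_hitCount_lt (n := n) P Metric.isOpen_ball.measurableSet hp hkp
  refine le_trans ?_ (add_le_add hcount hdev)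
  refine le_trans (measure_mono_ae ?_) (measure_union_le _ _)
  filter_upwards [ae_sample_mem_support n hΩ] with z hz herr
  by_contra hcon
  change z ∉ {z | hitCount (Metric.ball x r) z < k} ∪
    {z | s * neighbourSum (fun o => label o - ηP o.1) k z x ≤ -(k * m)} at hcon
  simp only [Set.mem_union, Set.mem_ofPred_eq, not_or, not_lt, not_le] at hcon
  refine herr (decide_half_le_eq hs ?_ hv)
  have := signed_knnEst_lower (η := ηP) (m := m) hk hcon.1 (fun i hi => hm _ (hz i) hi) hcon.2
  rwa [mul_div_cancel_left₀ _ hk0.ne', sub_self] at this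

/-- The threshold of the adaptive rule. -/
noncomputable def threshold (d n : ℕ) : ℝ := √(((d : ℝ) + Real.log n) * Real.log n)

/-- The adaptive rule stops before the neighbourhood grows beyond the radius `r` and, as the
threshold exceeds the noise level, on the correct side of `1/2`. -/
lemma adaptiveClassifier_eq {d n : ℕ} {η : Cov d → ℝ} {m r s v : ℝ} {k : ℕ} (hk : 1 ≤ k)
    (hs : s = 1 ∨ s = -1) (hm0 : 0 ≤ m) {z : Fin n → Obs d} {x : Cov d}
    (hkc : k ≤ hitCount (Metric.ball x r) z)
    (hm : ∀ i, ‖(z i).1 - x‖ < r → m ≤ s * (η (z i).1 - 1 / 2))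
    (hdev : ∀ j, 1 ≤ j → j ≤ n →
      -(√(j : ℝ) * threshold d n) < s * neighbourSum (fun o => label o - η o.1) j z x)
    (hsignal : 2 * threshold d n < √(k : ℝ) * m) (hv : 0 < s * (v - 1 / 2)) :
    adaptiveClassifier z x = decide (1 / 2 ≤ v) := by
  have hkn : k ≤ n := hkc.trans (hitCount_le _ _)
  have hlow : ∀ j, 1 ≤ j → j ≤ k →
      √(j : ℝ) * m - threshold d n < √(j : ℝ) * (s * (knnEst j z x - 1 / 2)) := by
    intro j hj hjk
    have hj0 : (0 : ℝ) < √(j : ℝ) := Real.sqrt_pos.2 (by exact_mod_cast hj)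
    have h1 := signed_knnEst_lower (η := η) (m := m) hj (hjk.trans hkc) hm
      (hdev j hj (hjk.trans hkn))
    have h2 : √(j : ℝ) * threshold d n / j = threshold d n / √(j : ℝ) := by
      rw [div_eq_div_iff (by positivity) hj0.ne', mul_right_comm,
        Real.mul_self_sqrt (Nat.cast_nonneg j), mul_comm]
    rw [h2] at h1
    have h3 := mul_lt_mul_of_pos_left h1 hj0
    rwa [mul_sub, mul_div_cancel₀ _ hj0.ne'] at h3
  have habs : ∀ w : ℝ, |s * w| = |w| := by
    intro w; rcases hs with rfl | rfl <;> simp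
  set A : Set ℕ := {k : ℕ | 1 ≤ k ∧
    (√(((d : ℝ) + Real.log n) * Real.log n) < √(k : ℝ) * |knnEst k z x - 1 / 2| ∨ k = n)}
  have hthr : threshold d n < √(k : ℝ) * |knnEst k z x - 1 / 2| := by
    have h1 := hlow k hk le_rfl
    rw [← habs]
    have h2 := mul_le_mul_of_nonneg_left (le_abs_self (s * (knnEst k z x - 1 / 2)))
      (Real.sqrt_nonneg (k : ℝ))
    linarith
  have hkA : k ∈ A := ⟨hk, Or.inl hthr⟩
  have hle : adaptiveK z x ≤ k := Nat.sInf_le hkA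
  obtain ⟨h1, h2⟩ : adaptiveK z x ∈ A := Nat.sInf_mem ⟨k, hkA⟩
  have hexceed : threshold d n < √(adaptiveK z x : ℝ) * |knnEst (adaptiveK z x) z x - 1 / 2| := by
    rcases h2 with h2 | h2
    · exact h2
    · -- stopping at the last index is stopping at `k = n`, where the threshold is exceeded
      have : adaptiveK z x = k := le_antisymm hle (by rw [h2]; exact hkn)
      rw [this]; exact hthr
  refine decide_half_le_eq hs ?_ hv
  by_contra hneg
  rw [not_lt] at hneg
  have h3 := hlow _ h1 hle
  have h4 : 0 ≤ √(adaptiveK z x : ℝ) * m := by positivity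
  rw [← habs, abs_of_nonpos hneg] at hexceed
  linarith

/-- A union bound over the numbers of neighbours suffices, since the threshold makes each of the
`n` deviation probabilities smaller than any power of `n`. -/
lemma measure_adaptive_error {d n : ℕ} {P : ProbabilityMeasure (Obs d)} {ηP : Cov d → ℝ}
    (hη : IsRegressionFunction P ηP) {Ω : Set (Cov d)} (hΩ : (covLaw P).support = Ω) {x : Cov d}
    {s m r p : ℝ} (hs : s = 1 ∨ s = -1) (hm0 : 0 ≤ m)
    (hm : ∀ x' ∈ Ω, ‖x' - x‖ < r → m ≤ s * (ηP x' - 1 / 2))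
    (hp : p ≤ (covLaw P).real (Metric.ball x r)) {k : ℕ} (hk : 1 ≤ k) (hkp : 2 * (k : ℝ) ≤ n * p)
    (hsignal : 2 * threshold d n < √(k : ℝ) * m) {v : ℝ} (hv : 0 < s * (v - 1 / 2)) :
    (Measure.pi fun _ : Fin n => (P : Measure (Obs d)))
      {z | adaptiveClassifier z x ≠ decide (1 / 2 ≤ v)} ≤
      ENNReal.ofReal (Real.exp (-(n * p / 8))) +
        n * ENNReal.ofReal (Real.exp (-(2 * threshold d n ^ 2))) := by
  have hT : 0 ≤ threshold d n := Real.sqrt_nonneg _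
  set E : ℕ → Set (Fin n → Obs d) := fun j => {z | s * neighbourSum (fun o => label o - ηP o.1) j z x ≤
    -(√(j : ℝ) * threshold d n)}
  have hdev : ∀ j ∈ Finset.Icc 1 n, (Measure.pi fun _ : Fin n => (P : Measure (Obs d))) (E j) ≤
      ENNReal.ofReal (Real.exp (-(2 * threshold d n ^ 2))) := by
    intro j hj
    rw [Finset.mem_Icc] at hj
    have hj0 : (j : ℝ) ≠ 0 := by have := hj.1; positivity
    have := measure_neighbourSum_deviation n hη x (k := j) hs (ε := √(j : ℝ) * threshold d n)
      (by positivity) hj.2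
    rwa [mul_pow, Real.sq_sqrt (Nat.cast_nonneg j),
      show 2 * ((j : ℝ) * threshold d n ^ 2) / j = 2 * threshold d n ^ 2 by field_simp] at this
  have hU : (Measure.pi fun _ : Fin n => (P : Measure (Obs d))) (⋃ j ∈ Finset.Icc 1 n, E j) ≤
      n * ENNReal.ofReal (Real.exp (-(2 * threshold d n ^ 2))) := by
    refine (measure_biUnion_finset_le _ _).trans ((Finset.sum_le_sum hdev).trans ?_)
    simp
  have hcount := measure_hitCount_lt (n := n) P Metric.isOpen_ball.measurableSet hp hkp
  refine le_trans ?_ (add_le_add hcount hU)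
  refine le_trans (measure_mono_ae ?_) (measure_union_le _ _)
  filter_upwards [ae_sample_mem_support n hΩ] with z hz herr
  by_contra hcon
  change z ∉ {z | hitCount (Metric.ball x r) z < k} ∪ ⋃ j ∈ Finset.Icc 1 n, E j at hcon
  simp only [Set.mem_union, Set.mem_ofPred_eq, not_or, not_lt, Set.mem_iUnion, not_exists,
    Finset.mem_Icc, E, not_le] at hcon
  exact herr (adaptiveClassifier_eq (η := ηP) hk hs hm0 hcon.1 (fun i hi => hm _ (hz i) hi)
    (fun j h1 h2 => hcon.2 j ⟨h1, h2⟩) hsignal hv)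

/-! ### The excess risk as a weighted misclassification probability -/

lemma measurable_condProbOne {d : ℕ} (Q : ProbabilityMeasure (Obs d)) :
    Measurable (condProbOne Q) :=
  (Kernel.measurable_coe _ (measurableSet_singleton true)).ennreal_toReal

lemma risk_eq_lintegral {d : ℕ} (Q : ProbabilityMeasure (Obs d)) {f : Cov d → Bool}
    (hf : Measurable f) :
    risk Q f = ∫⁻ x, (Q : Measure (Obs d)).condKernel x {!f x} ∂covLaw Q := by
  have hm : MeasurableSet {p : Obs d | f p.1 ≠ p.2} :=
    (measurableSet_eq_fun (hf.comp measurable_fst) measurable_snd).compl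
  rw [risk]
  conv_lhs => rw [← (Q : Measure (Obs d)).disintegrate (Q : Measure (Obs d)).condKernel]
  rw [Measure.compProd_apply hm]
  refine lintegral_congr fun x => ?_
  congr 1
  ext y
  simp only [Set.mem_preimage, Set.mem_ofPred_eq, Set.mem_singleton_iff]
  cases f x <;> cases y <;> simp

open scoped Classical in
lemma risk_le {d : ℕ} {Q : ProbabilityMeasure (Obs d)} {η : Cov d → ℝ}
    (hη : IsRegressionFunction Q η) {f : Cov d → Bool} (hf : Measurable f) :
    risk Q f ≤ risk Q (bayesClassifier Q) + ∫⁻ x, ENNReal.ofReal (2 * |η x - 1 / 2|) *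
      (if f x ≠ decide (1 / 2 ≤ η x) then 1 else 0) ∂covLaw Q := by
  have hb : Measurable (bayesClassifier Q) := measurable_decide_half_le (measurable_condProbOne Q)
  rw [risk_eq_lintegral Q hf, risk_eq_lintegral Q hb, ← lintegral_add_left]
  swap
  · have h1 : Measurable fun q : Bool × Cov d =>
        (Q : Measure (Obs d)).condKernel q.2 {!q.1} :=
      measurable_from_prod_countable_right fun b =>
        (Kernel.measurable_coe (Q : Measure (Obs d)).condKernel
          (measurableSet_singleton (!b))).comp measurable_id
    exact h1.comp (hb.prodMk measurable_id)
  refine lintegral_mono_ae ?_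
  filter_upwards [hη.ae_eq] with x hx
  have ht : (Q : Measure (Obs d)).condKernel x {true} = ENNReal.ofReal (η x) := by
    rw [hx, condProbOne, ofReal_measureReal]
  have hf' : (Q : Measure (Obs d)).condKernel x {false} = ENNReal.ofReal (1 - η x) := by
    have : ({false} : Set Bool) = {true}ᶜ := by ext b; cases b <;> simp
    rw [this, prob_compl_eq_one_sub (measurableSet_singleton _), ht,
      ENNReal.ofReal_sub _ (hη.mem_Icc x).1, ENNReal.ofReal_one]
  have hbx : bayesClassifier Q x = decide (1 / 2 ≤ η x) := by rw [bayesClassifier, hx]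
  rw [hbx]
  obtain ⟨h0, h1⟩ := hη.mem_Icc x
  by_cases he : f x = decide (1 / 2 ≤ η x)
  · rw [he]; exact le_self_add
  rw [if_pos he, mul_one]
  by_cases hh : 1 / 2 ≤ η x
  · rw [decide_eq_true hh] at he ⊢
    have : f x = false := by simpa using he
    rw [this, Bool.not_false, Bool.not_true, ht, hf', ← ENNReal.ofReal_add (by linarith) (by positivity)]
    refine ENNReal.ofReal_le_ofReal ?_
    rw [abs_of_nonneg (by linarith)]; linarith
  · rw [decide_eq_false hh] at he ⊢
    have : f x = true := by simpa using he
    rw [this, Bool.not_false, Bool.not_true, ht, hf', ← ENNReal.ofReal_add (by linarith) (by positivity)]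
    refine ENNReal.ofReal_le_ofReal ?_
    rw [abs_of_nonpos (by linarith)]; linarith

/-- The excess risk is at most the integral of `2 |ηQ - 1/2|` against the probability of
disagreeing with the Bayes classifier. -/
lemma excessRisk_le {d n : ℕ} {P Q : ProbabilityMeasure (Obs d)} {η : Cov d → ℝ}
    (hη : IsRegressionFunction Q η) {f : (Fin n → Obs d) → Cov d → Bool}
    (hf : Measurable fun p : (Fin n → Obs d) × Cov d => f p.1 p.2) {R : ℝ} (hR : 0 ≤ R)
    (h : ∫⁻ x, ENNReal.ofReal (2 * |η x - 1 / 2|) *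
      (Measure.pi fun _ : Fin n => (P : Measure (Obs d))) {z | f z x ≠ decide (1 / 2 ≤ η x)}
        ∂covLaw Q ≤ ENNReal.ofReal R) :
    excessRisk P Q f ≤ R := by
  classical
  set ν := Measure.pi fun _ : Fin n => (P : Measure (Obs d))
  have hset : MeasurableSet {p : (Fin n → Obs d) × Cov d | f p.1 p.2 ≠ decide (1 / 2 ≤ η p.2)} :=
    (measurableSet_eq_fun hf
      ((measurable_decide_half_le hη.measurable).comp measurable_snd)).compl
  have hkey : ∫⁻ z, risk Q (f z) ∂ν ≤ risk Q (bayesClassifier Q) + ENNReal.ofReal R := by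
    calc ∫⁻ z, risk Q (f z) ∂ν
        ≤ ∫⁻ z, (risk Q (bayesClassifier Q) + ∫⁻ x, ENNReal.ofReal (2 * |η x - 1 / 2|) *
          (if f z x ≠ decide (1 / 2 ≤ η x) then 1 else 0) ∂covLaw Q) ∂ν :=
          lintegral_mono fun z => risk_le hη (hf.comp measurable_prodMk_left)
      _ = risk Q (bayesClassifier Q) + ∫⁻ z, ∫⁻ x, ENNReal.ofReal (2 * |η x - 1 / 2|) *
          (if f z x ≠ decide (1 / 2 ≤ η x) then 1 else 0) ∂covLaw Q ∂ν := by
          rw [lintegral_add_left measurable_const]; simp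
      _ = risk Q (bayesClassifier Q) + ∫⁻ x, ∫⁻ z, ENNReal.ofReal (2 * |η x - 1 / 2|) *
          (if f z x ≠ decide (1 / 2 ≤ η x) then 1 else 0) ∂ν ∂covLaw Q := by
          rw [lintegral_lintegral_swap]
          have hη' := hη.measurable
          refine (Measurable.mul (by fun_prop)
            (Measurable.ite hset measurable_const measurable_const)).aemeasurable
      _ ≤ _ := by
          refine add_le_add le_rfl (le_trans (le_of_eq ?_) h)
          refine lintegral_congr fun x => ?_
          have hsx : MeasurableSet {z | f z x ≠ decide (1 / 2 ≤ η x)} :=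
            measurable_prodMk_right hset
          rw [lintegral_const_mul _ (Measurable.ite hsx measurable_const measurable_const)]
          congr 1
          rw [← lintegral_indicator_one hsx]
          exact lintegral_congr fun z => by simp [Set.indicator_apply]
  have hfin : risk Q (bayesClassifier Q) ≠ ⊤ := measure_ne_top _ _
  rw [excessRisk, sub_le_iff_le_add']
  refine ENNReal.toReal_le_of_le_ofReal (by positivity) ?_
  rwa [ENNReal.ofReal_add ENNReal.toReal_nonneg hR, ENNReal.ofReal_toReal hfin]

/-! ### Integration against the noise condition -/

lemma exists_exp_neg_le_rpow {c q : ℝ} (hc : 0 < c) (hq : 0 ≤ q) :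
    ∃ C : ℝ, 0 < C ∧ ∀ w : ℝ, 0 < w → Real.exp (-(c * w)) ≤ C * w ^ (-q) := by
  obtain ⟨N, hN⟩ := exists_nat_ge q
  refine ⟨max 1 (N.factorial / c ^ N), by positivity, fun w hw => ?_⟩
  rcases le_total 1 w with h1 | h1
  · have h2 := Real.pow_div_factorial_le_exp (c * w) (by positivity) N
    have h3 : w ^ (-(N : ℝ)) ≤ w ^ (-q) := Real.rpow_le_rpow_of_exponent_le h1 (by linarith)
    calc Real.exp (-(c * w)) = (Real.exp (c * w))⁻¹ := Real.exp_neg _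
      _ ≤ ((c * w) ^ N / N.factorial)⁻¹ := inv_anti₀ (by positivity) h2
      _ = N.factorial / c ^ N * w ^ (-(N : ℝ)) := by
          rw [Real.rpow_neg hw.le, Real.rpow_natCast, mul_pow]; field_simp
      _ ≤ _ := mul_le_mul (le_max_right _ _) h3 (by positivity) (by positivity)
  · calc Real.exp (-(c * w)) ≤ 1 := Real.exp_le_one_iff.2 (by nlinarith)
      _ ≤ w ^ (-q) := Real.one_le_rpow_of_pos_of_le_one_of_nonpos hw h1 (by linarith)
      _ ≤ _ := le_mul_of_one_le_left (by positivity) (le_max_left _ _)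

lemma TsybakovNoise.extend {d : ℕ} {μ : Measure (Cov d)} [IsProbabilityMeasure μ] {η : Cov d → ℝ}
    {C α : ℝ} (h : TsybakovNoise μ η C α) (hα : 0 ≤ α) {t : ℝ} (ht : 0 < t) :
    μ {x | |η x - 1 / 2| < t} ≤ ENNReal.ofReal (max C (2 ^ α) * t ^ α) := by
  rw [← ofReal_measureReal]
  refine ENNReal.ofReal_le_ofReal ?_
  have ht' : 0 ≤ t ^ α := by positivity
  rcases le_total t (1 / 2) with h1 | h1
  · exact (h t ht h1).trans (mul_le_mul_of_nonneg_right (le_max_left _ _) ht')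
  · calc _ ≤ (1 : ℝ) := measureReal_le_one
      _ ≤ (2 * t) ^ α := Real.one_le_rpow (by linarith) hα
      _ = 2 ^ α * t ^ α := Real.mul_rpow (by norm_num) ht.le
      _ ≤ _ := mul_le_mul_of_nonneg_right (le_max_right _ _) ht'

open scoped Classical in
/-- A dyadic majorant of `u * exp (-c u ^ (2γ))`. -/
lemma exists_dyadic_majorant {c γ α : ℝ} (hc : 0 < c) (hγ : 0 < γ) (hα : 0 ≤ α) :
    ∃ M : ℝ, 0 < M ∧ ∀ u : ℝ, 0 ≤ u →
      ENNReal.ofReal (u * Real.exp (-(c * u ^ (2 * γ)))) ≤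
        ∑' j : ℕ, ENNReal.ofReal (M * ((2 : ℝ) ^ j) ^ (-(1 + α))) * if u < 2 ^ j then 1 else 0 := by
  obtain ⟨C, hC, hexp⟩ := exists_exp_neg_le_rpow hc (q := (2 + α) / (2 * γ)) (by positivity)
  refine ⟨max 1 (C * 2 ^ (1 + α)), by positivity, fun u hu => ?_⟩
  have hex : ∃ j : ℕ, u < 2 ^ j := pow_unbounded_of_one_lt u one_lt_two
  set j := Nat.find hex
  refine le_trans ?_ (ENNReal.le_tsum j)
  rw [if_pos (Nat.find_spec hex), mul_one]
  refine ENNReal.ofReal_le_ofReal ?_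
  by_cases hj : j = 0
  · have hu1 : u < 1 := by simpa [j, hj] using Nat.find_spec hex
    rw [hj, pow_zero, Real.one_rpow, mul_one]
    refine le_trans ?_ (le_max_left _ _)
    exact mul_le_one₀ hu1.le (Real.exp_pos _).le
      (Real.exp_le_one_iff.2 (neg_nonpos.2 (by positivity)))
  · have hpred : (2 : ℝ) ^ (j - 1) ≤ u := not_lt.1 (Nat.find_min hex (Nat.sub_one_lt hj))
    have hu0 : 0 < u := lt_of_lt_of_le (by positivity) hpred
    have h1 := hexp (u ^ (2 * γ)) (by positivity)
    rw [← Real.rpow_mul hu, show 2 * γ * -((2 + α) / (2 * γ)) = -(1 + α) - 1 by field_simp; ring,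
      Real.rpow_sub_one hu0.ne'] at h1
    have h2 : (2 : ℝ) ^ j = 2 * 2 ^ (j - 1) := by
      rw [← pow_succ', Nat.sub_one_add_one hj]
    calc u * Real.exp (-(c * u ^ (2 * γ))) ≤ u * (C * (u ^ (-(1 + α)) / u)) := by gcongr
      _ = C * u ^ (-(1 + α)) := by field_simp
      _ ≤ C * ((2 : ℝ) ^ (j - 1)) ^ (-(1 + α)) := by
          refine mul_le_mul_of_nonneg_left ?_ hC.le
          exact Real.rpow_le_rpow_of_nonpos (by positivity) hpred (by linarith)
      _ = C * 2 ^ (1 + α) * ((2 : ℝ) ^ j) ^ (-(1 + α)) := by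
          rw [h2, Real.mul_rpow (by norm_num) (by positivity), Real.rpow_neg (by norm_num : (0:ℝ) ≤ 2)]
          have : (2 : ℝ) ^ (1 + α) ≠ 0 := by positivity
          field_simp
      _ ≤ _ := by gcongr; exact le_max_right _ _

/-- Under the noise condition, sub-Gaussian tails in `(|η - 1/2| / τ) ^ γ` integrate to the
order `τ ^ (1 + α)`; the proof slices the space into dyadic shells of `|η - 1/2| / τ`. -/
lemma exists_lintegral_exp_le {c γ α C : ℝ} (hc : 0 < c) (hγ : 0 < γ) (hα : 0 ≤ α) :
    ∃ K : ℝ, 0 < K ∧ ∀ (d : ℕ) (μ : Measure (Cov d)) [IsProbabilityMeasure μ] (η : Cov d → ℝ),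
      Measurable η → TsybakovNoise μ η C α → ∀ τ : ℝ, 0 < τ →
      ∫⁻ x, ENNReal.ofReal (|η x - 1 / 2| * Real.exp (-(c * (|η x - 1 / 2| / τ) ^ (2 * γ)))) ∂μ ≤
        ENNReal.ofReal (K * τ ^ (1 + α)) := by
  classical
  obtain ⟨M, hM, hmaj⟩ := exists_dyadic_majorant hc hγ hα
  set C' : ℝ := max C (2 ^ α)
  have hC' : 0 < C' := lt_of_lt_of_le (by positivity) (le_max_right _ _)
  refine ⟨M * C' * 2, by positivity, fun d μ _ η hη hT τ hτ => ?_⟩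
  set u : Cov d → ℝ := fun x => |η x - 1 / 2| / τ
  have hset : ∀ j : ℕ, {x | u x < 2 ^ j} = {x | |η x - 1 / 2| < 2 ^ j * τ} := by
    intro j; ext x; simp only [u, Set.mem_ofPred_eq]; rw [div_lt_iff₀ hτ]
  have hmeas : ∀ j : ℕ, MeasurableSet {x | u x < 2 ^ j} := fun j =>
    measurableSet_lt (by fun_prop) measurable_const
  calc ∫⁻ x, ENNReal.ofReal (|η x - 1 / 2| * Real.exp (-(c * (|η x - 1 / 2| / τ) ^ (2 * γ)))) ∂μ
      = ∫⁻ x, ENNReal.ofReal τ * ENNReal.ofReal (u x * Real.exp (-(c * u x ^ (2 * γ)))) ∂μ := by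
        refine lintegral_congr fun x => ?_
        rw [← ENNReal.ofReal_mul hτ.le, ← mul_assoc, mul_div_cancel₀ _ hτ.ne']
    _ ≤ ∫⁻ x, ENNReal.ofReal τ * ∑' j : ℕ, ENNReal.ofReal (M * ((2 : ℝ) ^ j) ^ (-(1 + α))) *
          (if u x < 2 ^ j then 1 else 0) ∂μ := by
        refine lintegral_mono fun x => ?_
        gcongr
        exact hmaj (u x) (by positivity)
    _ = ENNReal.ofReal τ * ∑' j : ℕ, ENNReal.ofReal (M * ((2 : ℝ) ^ j) ^ (-(1 + α))) *
          μ {x | |η x - 1 / 2| < 2 ^ j * τ} := by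
        rw [lintegral_const_mul', lintegral_tsum]
        · congr 1
          refine tsum_congr fun j => ?_
          rw [lintegral_const_mul' _ _ ENNReal.ofReal_ne_top, ← hset j,
            ← lintegral_indicator_one (hmeas j)]
          refine congrArg _ (lintegral_congr fun z => ?_)
          simp [Set.indicator_apply]
        · intro j
          exact (measurable_const.mul
            (Measurable.ite (hmeas j) measurable_const measurable_const)).aemeasurable
        · exact ENNReal.ofReal_ne_top
    _ ≤ ENNReal.ofReal τ * ∑' j : ℕ, ENNReal.ofReal (M * C' * τ ^ α * (1 / 2) ^ j) := by
        gcongr with j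
        refine (mul_le_mul_right (hT.extend hα (t := 2 ^ j * τ) (by positivity)) _).trans (le_of_eq ?_)
        rw [← ENNReal.ofReal_mul (by positivity)]
        congr 1
        rw [Real.mul_rpow (by positivity) hτ.le, neg_add, Real.rpow_add (by positivity),
          Real.rpow_neg_one, Real.rpow_neg (by positivity), one_div, inv_pow]
        have : ((2 : ℝ) ^ j) ^ α ≠ 0 := by positivity
        change M * _ * (C' * _) = _
        field_simp
    _ = _ := by
        rw [← ENNReal.ofReal_tsum_of_nonneg (fun j => by positivity)
          (summable_geometric_two.mul_left _), tsum_mul_left, tsum_geometric_two,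
          ← ENNReal.ofReal_mul hτ.le, Real.rpow_add hτ, Real.rpow_one]
        congr 1; ring

/-- From misclassification probabilities to the excess risk: points with `|ηQ - 1/2| < A τ`
contribute `τ ^ (1 + α)` by the noise condition, whatever the classifier does there. -/
lemma exists_excessRisk_le {A c γ α C : ℝ} (hA : 0 < A) (hc : 0 < c) (hγ : 0 < γ) (hα : 0 ≤ α) :
    ∃ K : ℝ, 0 < K ∧ ∀ (d n : ℕ) (P Q : ProbabilityMeasure (Obs d)) (η : Cov d → ℝ)
      (f : (Fin n → Obs d) → Cov d → Bool) (Ω : Set (Cov d)) (τ B : ℝ),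
      IsRegressionFunction Q η → TsybakovNoise (covLaw Q) η C α → (covLaw Q).support = Ω →
      Measurable (fun p : (Fin n → Obs d) × Cov d => f p.1 p.2) → 0 < τ → 0 ≤ B →
      (∀ x ∈ Ω, A * τ ≤ |η x - 1 / 2| →
        (Measure.pi fun _ : Fin n => (P : Measure (Obs d))) {z | f z x ≠ decide (1 / 2 ≤ η x)} ≤
          ENNReal.ofReal (B + Real.exp (-(c * (|η x - 1 / 2| / τ) ^ (2 * γ))))) →
      excessRisk P Q f ≤ K * τ ^ (1 + α) + B := by
  obtain ⟨K, hK, hint⟩ := exists_lintegral_exp_le (C := C) hc hγ hα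
  set C' : ℝ := max C (2 ^ α)
  have hC' : 0 < C' := lt_of_lt_of_le (by positivity) (le_max_right _ _)
  refine ⟨2 * A * (C' * A ^ α) + 2 * K, by positivity,
    fun d n P Q η f Ω τ B hη hT hΩ hf hτ hB hpt => excessRisk_le hη hf (by positivity) ?_⟩
  have hAτ : 0 < A * τ := by positivity
  have hηm := hη.measurable
  set S : Set (Cov d) := {x | |η x - 1 / 2| < A * τ}
  have hS : MeasurableSet S := measurableSet_lt (by fun_prop) measurable_const
  calc ∫⁻ x, ENNReal.ofReal (2 * |η x - 1 / 2|) *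
      (Measure.pi fun _ : Fin n => (P : Measure (Obs d))) {z | f z x ≠ decide (1 / 2 ≤ η x)}
        ∂covLaw Q
      ≤ ∫⁻ x, (S.indicator (fun _ => ENNReal.ofReal (2 * (A * τ))) x + (ENNReal.ofReal B +
        ENNReal.ofReal 2 * ENNReal.ofReal
          (|η x - 1 / 2| * Real.exp (-(c * (|η x - 1 / 2| / τ) ^ (2 * γ)))))) ∂covLaw Q := by
        refine lintegral_mono_ae ?_
        filter_upwards [ae_mem_support hΩ] with x hx
        by_cases hxS : x ∈ S
        · rw [Set.indicator_of_mem hxS]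
          refine le_trans ?_ le_self_add
          calc _ ≤ ENNReal.ofReal (2 * |η x - 1 / 2|) * 1 := by gcongr; exact prob_le_one
            _ ≤ _ := by
              rw [mul_one]
              exact ENNReal.ofReal_le_ofReal (mul_le_mul_of_nonneg_left (le_of_lt hxS) (by norm_num))
        · rw [Set.indicator_of_notMem hxS, zero_add]
          have h1 := hpt x hx (not_lt.1 hxS)
          have h2 : 2 * |η x - 1 / 2| ≤ 1 := by
            obtain ⟨h3, h4⟩ := hη.mem_Icc x
            have : |η x - 1 / 2| ≤ 1 / 2 := abs_le.2 ⟨by linarith, by linarith⟩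
            linarith
          have h0 : 0 ≤ |η x - 1 / 2| := abs_nonneg _
          refine (mul_le_mul_right h1 _).trans ?_
          rw [← ENNReal.ofReal_mul (by positivity), ← ENNReal.ofReal_mul (by positivity),
            ← ENNReal.ofReal_add hB (by positivity)]
          refine ENNReal.ofReal_le_ofReal ?_
          nlinarith
    _ = ENNReal.ofReal (2 * (A * τ)) * covLaw Q S + (ENNReal.ofReal B + ENNReal.ofReal 2 *
          ∫⁻ x, ENNReal.ofReal
          (|η x - 1 / 2| * Real.exp (-(c * (|η x - 1 / 2| / τ) ^ (2 * γ)))) ∂covLaw Q) := by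
        rw [lintegral_add_left (measurable_const.indicator hS), lintegral_indicator_const hS,
          lintegral_add_left measurable_const, lintegral_const_mul' _ _ ENNReal.ofReal_ne_top]
        simp
    _ ≤ ENNReal.ofReal (2 * (A * τ)) * ENNReal.ofReal (C' * (A * τ) ^ α) +
        (ENNReal.ofReal B + ENNReal.ofReal 2 * ENNReal.ofReal (K * τ ^ (1 + α))) := by
        gcongr
        · exact hT.extend hα hAτ
        · exact hint d _ η hηm hT τ hτ
    _ = _ := by
        rw [← ENNReal.ofReal_mul (by positivity), ← ENNReal.ofReal_mul (by positivity),
          ← ENNReal.ofReal_add hB (by positivity), ← ENNReal.ofReal_add (by positivity) (by positivity),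
          Real.mul_rpow hA.le hτ.le, Real.rpow_add hτ, Real.rpow_one]
        congr 1; ring

/-! ### The local margin under source or target smoothness -/

lemma RelativeSignal.signed {d : ℕ} {ηP ηQ : Cov d → ℝ} {Ω : Set (Cov d)} {C γ : ℝ}
    (h : RelativeSignal ηP ηQ Ω C γ) {x : Cov d} (hx : x ∈ Ω) {s : ℝ} (hs : s = 1 ∨ s = -1)
    (hpos : 0 < s * (ηQ x - 1 / 2)) :
    C * (s * (ηQ x - 1 / 2)) ^ γ ≤ s * (ηP x - 1 / 2) := by
  obtain ⟨h1, h2⟩ := h x hx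
  have hss : s * s = 1 := by rcases hs with rfl | rfl <;> norm_num
  have habs : ∀ w : ℝ, 0 ≤ s * w → |w| = s * w := by
    intro w hw
    rw [← abs_of_nonneg hw]
    rcases hs with rfl | rfl <;> simp
  have h3 : 0 ≤ s * (ηP x - 1 / 2) := by
    refine nonneg_of_mul_nonneg_left ?_ hpos
    calc 0 ≤ (ηP x - 1 / 2) * (ηQ x - 1 / 2) := h1
      _ = s * s * ((ηP x - 1 / 2) * (ηQ x - 1 / 2)) := by rw [hss, one_mul]
      _ = _ := by ring
  rwa [habs _ hpos.le, habs _ h3] at h2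

lemma HolderSmoothOn.signed_lower {d : ℕ} {η : Cov d → ℝ} {Ω : Set (Cov d)} {C β ρ : ℝ}
    (h : HolderSmoothOn η Ω C β) (hC : 0 < C) (hβ : 0 < β) {x x' : Cov d} (hx : x ∈ Ω)
    (hx' : x' ∈ Ω) (hρ : 0 ≤ ρ) (hxx : ‖x' - x‖ ≤ (ρ / C) ^ (1 / β)) {s : ℝ} (hs : s = 1 ∨ s = -1) :
    s * (η x - 1 / 2) - ρ ≤ s * (η x' - 1 / 2) := by
  have h1 : ‖x' - x‖ ^ β ≤ ρ / C := by
    calc ‖x' - x‖ ^ β ≤ ((ρ / C) ^ (1 / β)) ^ β := by gcongr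
      _ = ρ / C := by
        rw [← Real.rpow_mul (by positivity), one_div_mul_cancel hβ.ne', Real.rpow_one]
  have h2 : |η x' - η x| ≤ ρ := by
    refine (h x' hx' x hx).trans ?_
    calc C * ‖x' - x‖ ^ β ≤ C * (ρ / C) := by gcongr
      _ = ρ := by field_simp
  obtain ⟨h3, h4⟩ := abs_le.1 h2
  rcases hs with rfl | rfl <;> linarith

lemma localMargin_of_source_smooth {d : ℕ} {ηP ηQ : Cov d → ℝ} {Ω : Set (Cov d)}
    {Cβ β Cγ γ : ℝ} (hCβ : 0 < Cβ) (hβ : 0 < β) (hCγ : 0 < Cγ) (hγ : 0 < γ)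
    (hP : HolderSmoothOn ηP Ω Cβ β) (hrel : RelativeSignal ηP ηQ Ω Cγ γ) :
    LocalMargin ηP ηQ Ω γ (β / γ) (Cγ / 2) ((Cγ / (2 * Cβ)) ^ (1 / β)) := by
  intro x hx x' hx' s hs hpos hdist
  set D := s * (ηQ x - 1 / 2)
  have h1 := hP.signed_lower hCβ hβ hx hx' (ρ := Cγ / 2 * D ^ γ) (by positivity) (s := s) (by
    refine hdist.le.trans (le_of_eq ?_)
    rw [show Cγ / 2 * D ^ γ / Cβ = Cγ / (2 * Cβ) * D ^ γ by field_simp,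
      Real.mul_rpow (x := Cγ / (2 * Cβ)) (y := D ^ γ) (by positivity) (by positivity),
      ← Real.rpow_mul hpos.le]
    congr 2
    field_simp) hs
  have h2 := hrel.signed hx hs hpos
  linarith

lemma localMargin_of_target_smooth {d : ℕ} {ηP ηQ : Cov d → ℝ} {Ω : Set (Cov d)}
    {Cβ β Cγ γ : ℝ} (hCβ : 0 < Cβ) (hβ : 0 < β) (hCγ : 0 < Cγ) (hγ : 0 < γ)
    (hQ : HolderSmoothOn ηQ Ω Cβ β) (hrel : RelativeSignal ηP ηQ Ω Cγ γ) :
    LocalMargin ηP ηQ Ω γ β (Cγ / 2 ^ γ) ((1 / (2 * Cβ)) ^ (1 / β)) := by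
  intro x hx x' hx' s hs hpos hdist
  set D := s * (ηQ x - 1 / 2)
  have h1 := hQ.signed_lower hCβ hβ hx hx' (ρ := D / 2) (by positivity) (s := s) (by
    refine hdist.le.trans (le_of_eq ?_)
    rw [show D / 2 / Cβ = 1 / (2 * Cβ) * D by field_simp,
      Real.mul_rpow (by positivity) hpos.le]) hs
  have h2 : D / 2 ≤ s * (ηQ x' - 1 / 2) := by
    have : s * (ηQ x - 1 / 2) = D := rfl
    linarith
  have h3 := hrel.signed hx' hs (lt_of_lt_of_le (by positivity) h2)
  refine le_trans ?_ h3
  calc Cγ / 2 ^ γ * D ^ γ = Cγ * (D / 2) ^ γ := by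
        rw [Real.div_rpow hpos.le (by norm_num)]; ring
    _ ≤ _ := by gcongr

/-! ### Misclassification at the scale of the rate -/

lemma exists_sign (w : ℝ) :
    ∃ s : ℝ, (s = 1 ∨ s = -1) ∧ s * w = |w| := by
  rcases le_total 0 w with h | h
  · exact ⟨1, Or.inl rfl, by rw [abs_of_nonneg h, one_mul]⟩
  · exact ⟨-1, Or.inr rfl, by rw [abs_of_nonpos h]; ring⟩

/-- The data shared by the two pointwise bounds: a scale `τ` of `|ηQ - 1/2|`, the matching radius
`R * τ ^ (1/b)`, at which the expected number of neighbours is of order `ℓ * τ ^ (-2γ)`. -/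
lemma exists_signal_and_mass {d n : ℕ} (hd : 1 ≤ d) {θ : Params} (hθ : θ.Admissible)
    {P Q : ProbabilityMeasure (Obs d)} {Ω : Set (Cov d)} {ηP ηQ : Cov d → ℝ}
    (hsd : CommonSupportStrongDensity θ P Q Ω) {b c₁ c₂ : ℝ} (hb : 0 < b)
    (hc₂ : 0 < c₂) (hmargin : LocalMargin ηP ηQ Ω θ.γ b c₁ c₂)
    {τ ℓ R A : ℝ} (hτ : 0 < τ) (hℓ : n * τ ^ (d / b) = ℓ * τ ^ (-(2 * θ.γ))) (hR : 0 < R)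
    (hsmall : R * τ ^ (1 / b) < θ.rLam) (hA : (R / c₂) ^ b ≤ A)
    {x : Cov d} (hx : x ∈ Ω) (hxτ : A * τ ≤ |ηQ x - 1 / 2|) :
    ∃ s p : ℝ, (s = 1 ∨ s = -1) ∧ 0 < s * (ηQ x - 1 / 2) ∧
      (∀ x' ∈ Ω, ‖x' - x‖ < R * τ ^ (1 / b) → c₁ * |ηQ x - 1 / 2| ^ θ.γ ≤ s * (ηP x' - 1 / 2)) ∧
      p ≤ (covLaw P).real (Metric.ball x (R * τ ^ (1 / b))) ∧
      n * p = θ.cLam ^ 2 * unitBallVol d * R ^ d * (ℓ * τ ^ (-(2 * θ.γ))) := by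
  have hA0 : 0 < A := lt_of_lt_of_le (by positivity) hA
  have hpos : 0 < |ηQ x - 1 / 2| := lt_of_lt_of_le (by positivity) hxτ
  obtain ⟨s, hs, hsw⟩ := exists_sign (ηQ x - 1 / 2)
  refine ⟨s, _, hs, by rw [hsw]; exact hpos, ?_,
    ball_mass_lower hd hθ hsd hx (by positivity) hsmall, ?_⟩
  · intro x' hx' hlt
    rw [← hsw]
    refine hmargin x hx x' hx' s hs (by rw [hsw]; exact hpos) (lt_of_lt_of_le hlt ?_)
    rw [hsw]
    have h1 : R = c₂ * ((R / c₂) ^ b) ^ (1 / b) := by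
      rw [← Real.rpow_mul (by positivity), mul_one_div_cancel hb.ne', Real.rpow_one]; field_simp
    calc R * τ ^ (1 / b) = c₂ * (((R / c₂) ^ b) * τ) ^ (1 / b) := by
          rw [Real.mul_rpow (by positivity) hτ.le]
          conv_lhs => rw [h1]
          ring
      _ ≤ c₂ * |ηQ x - 1 / 2| ^ (1 / b) := by
          gcongr
          exact (mul_le_mul_of_nonneg_right hA hτ.le).trans hxτ
  · rw [← hℓ, mul_pow, ← Real.rpow_natCast (τ ^ (1 / b)) d, ← Real.rpow_mul hτ.le,
      one_div_mul_eq_div]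
    ring

lemma rpow_two_mul_eq_sq {u γ : ℝ} (hu : 0 ≤ u) : u ^ (2 * γ) = (u ^ γ) ^ 2 := by
  rw [mul_comm, Real.rpow_mul hu, Real.rpow_two]

lemma rpow_neg_mul_rpow {u τ γ : ℝ} (hu : 0 ≤ u) (hτ : 0 < τ) :
    τ ^ (-(2 * γ)) * (u ^ γ) ^ 2 = (u / τ) ^ (2 * γ) := by
  rw [Real.div_rpow hu hτ.le, Real.rpow_neg hτ.le, rpow_two_mul_eq_sq hu]; field_simp

lemma knn_error_at_scale {d n : ℕ} (hd : 1 ≤ d) {θ : Params} (hθ : θ.Admissible)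
    {P Q : ProbabilityMeasure (Obs d)} {Ω : Set (Cov d)} {ηP ηQ : Cov d → ℝ}
    (hηP : IsRegressionFunction P ηP)
    (hsd : CommonSupportStrongDensity θ P Q Ω) {b c₁ c₂ : ℝ} (hb : 0 < b) (hc₁ : 0 < c₁)
    (hc₂ : 0 < c₂) (hmargin : LocalMargin ηP ηQ Ω θ.γ b c₁ c₂)
    {τ R a A' : ℝ} (hτ : 0 < τ) (hℓ : n * τ ^ (d / b) = τ ^ (-(2 * θ.γ))) (hR : 0 < R)
    (hsmall : R * τ ^ (1 / b) < θ.rLam)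
    (hRA : 2 * A' ≤ θ.cLam ^ 2 * unitBallVol d * R ^ d) {k : ℕ} (hk : 1 ≤ k)
    (hka : a * τ ^ (-(2 * θ.γ)) ≤ k) (hkA : k ≤ A' * τ ^ (-(2 * θ.γ)))
    {x : Cov d} (hx : x ∈ Ω) (hxτ : (R / c₂) ^ b * τ ≤ |ηQ x - 1 / 2|) :
    (Measure.pi fun _ : Fin n => (P : Measure (Obs d)))
      {z | decide (1 / 2 ≤ knnEst k z x) ≠ decide (1 / 2 ≤ ηQ x)} ≤
      ENNReal.ofReal (Real.exp (-(θ.cLam ^ 2 * unitBallVol d * R ^ d / 8 * τ ^ (-(2 * θ.γ)))) +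
        Real.exp (-(2 * a * c₁ ^ 2 * (|ηQ x - 1 / 2| / τ) ^ (2 * θ.γ)))) := by
  obtain ⟨s, p, hs, hspos, hm, hp, hnp⟩ := exists_signal_and_mass hd hθ hsd hb hc₂ hmargin hτ
    (by rw [hℓ, one_mul]) hR hsmall le_rfl hx hxτ
  rw [one_mul] at hnp
  have hT : 0 ≤ τ ^ (-(2 * θ.γ)) := by positivity
  have h1 := measure_knn_error hηP hsd.support_P hs (by positivity) hm hp hk (by
    rw [hnp]
    nlinarith [mul_le_mul_of_nonneg_right hRA hT]) hspos
  refine h1.trans ?_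
  rw [← ENNReal.ofReal_add (by positivity) (by positivity)]
  refine ENNReal.ofReal_le_ofReal (add_le_add ?_ ?_)
  · rw [hnp]; refine Real.exp_le_exp.2 (le_of_eq ?_); ring
  · refine Real.exp_le_exp.2 (neg_le_neg ?_)
    rw [← rpow_neg_mul_rpow (abs_nonneg _) hτ]
    calc 2 * a * c₁ ^ 2 * (τ ^ (-(2 * θ.γ)) * (|ηQ x - 1 / 2| ^ θ.γ) ^ 2)
        = 2 * (a * τ ^ (-(2 * θ.γ))) * (c₁ * |ηQ x - 1 / 2| ^ θ.γ) ^ 2 := by ring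
      _ ≤ 2 * k * (c₁ * |ηQ x - 1 / 2| ^ θ.γ) ^ 2 := by gcongr

lemma adaptive_error_at_scale {d n : ℕ} (hd : 1 ≤ d) {θ : Params} (hθ : θ.Admissible)
    {P Q : ProbabilityMeasure (Obs d)} {Ω : Set (Cov d)} {ηP ηQ : Cov d → ℝ}
    (hηP : IsRegressionFunction P ηP)
    (hsd : CommonSupportStrongDensity θ P Q Ω) {b c₁ c₂ : ℝ} (hb : 0 < b) (hc₁ : 0 < c₁)
    (hc₂ : 0 < c₂) (hmargin : LocalMargin ηP ηQ Ω θ.γ b c₁ c₂)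
    {τ A : ℝ} (hτ : 0 < τ) (hL : 1 ≤ Real.log n)
    (hℓ : n * τ ^ (d / b) = Real.log n ^ 2 * τ ^ (-(2 * θ.γ)))
    (hsmall : τ ^ (1 / b) < θ.rLam)
    (hbig : 2 ≤ θ.cLam ^ 2 * unitBallVol d * (Real.log n ^ 2 * τ ^ (-(2 * θ.γ))))
    (hA : (1 / c₂) ^ b ≤ A)
    (hA' : 16 * (d + 1) < θ.cLam ^ 2 * unitBallVol d * c₁ ^ 2 * A ^ (2 * θ.γ))
    {x : Cov d} (hx : x ∈ Ω) (hxτ : A * τ ≤ |ηQ x - 1 / 2|) :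
    (Measure.pi fun _ : Fin n => (P : Measure (Obs d)))
      {z | adaptiveClassifier z x ≠ decide (1 / 2 ≤ ηQ x)} ≤
      ENNReal.ofReal (Real.exp (-(θ.cLam ^ 2 * unitBallVol d / 8 * τ ^ (-(2 * θ.γ)))) +
        Real.exp (-Real.log n ^ 2)) := by
  obtain ⟨s, p, hs, hspos, hm, hp, hnp⟩ := exists_signal_and_mass hd hθ hsd hb hc₂ hmargin hτ
    hℓ one_pos (by rwa [one_mul]) hA hx hxτ
  rw [one_pow, mul_one] at hnp
  have hA0 : 0 < A := lt_of_lt_of_le (by positivity) hA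
  have hV : 0 < θ.cLam ^ 2 * unitBallVol d :=
    mul_pos (pow_pos hθ.cLam_pos 2) (unitBallVol_pos d)
  have hγ := hθ.γ_pos
  set V := θ.cLam ^ 2 * unitBallVol d
  set L := Real.log n
  set T := τ ^ (-(2 * θ.γ))
  have hT : 0 < T := by positivity
  set Δ := |ηQ x - 1 / 2|
  have hthr : threshold d n ^ 2 = (d + L) * L := Real.sq_sqrt (by positivity)
  have hd0 : (0 : ℝ) ≤ d := Nat.cast_nonneg d
  -- half of the expected number of sample points in the ball, rounded down
  set k := ⌊n * p / 2⌋₊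
  have hnp2 : 2 ≤ n * p := by rw [hnp]; exact hbig
  have hk : 1 ≤ k := Nat.le_floor (by push_cast; linarith)
  have hkle : (k : ℝ) ≤ n * p / 2 := Nat.floor_le (by linarith)
  have hkge : n * p / 4 ≤ k := by
    have h1 := Nat.lt_floor_add_one (n * p / 2)
    have h2 : (1 : ℝ) ≤ k := by exact_mod_cast hk
    have h3 : n * p / 2 < k + 1 := h1
    linarith
  have hsignal : 2 * threshold d n < √(k : ℝ) * (c₁ * Δ ^ θ.γ) := by
    refine lt_of_pow_lt_pow_left₀ 2 (by positivity) ?_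
    rw [mul_pow, hthr, mul_pow, Real.sq_sqrt (Nat.cast_nonneg k)]
    have hΔ : A ^ (2 * θ.γ) ≤ T * (Δ ^ θ.γ) ^ 2 := by
      rw [rpow_neg_mul_rpow (abs_nonneg _) hτ]
      exact Real.rpow_le_rpow hA0.le (by rwa [le_div_iff₀ hτ]) (by positivity)
    calc (2 : ℝ) ^ 2 * ((d + L) * L) ≤ 4 * (d + 1) * L ^ 2 := by
          nlinarith [mul_nonneg hd0 (mul_nonneg (sub_nonneg.2 hL) (zero_le_one.trans hL))]
      _ < V * c₁ ^ 2 * A ^ (2 * θ.γ) / 4 * L ^ 2 := by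
          refine mul_lt_mul_of_pos_right ?_ (by positivity)
          linarith
      _ ≤ V * c₁ ^ 2 * (T * (Δ ^ θ.γ) ^ 2) / 4 * L ^ 2 := by gcongr
      _ = V * (L ^ 2 * T) / 4 * (c₁ * Δ ^ θ.γ) ^ 2 := by ring
      _ ≤ k * (c₁ * Δ ^ θ.γ) ^ 2 := by
          rw [← hnp]
          exact mul_le_mul_of_nonneg_right hkge (by positivity)
  have h1 := measure_adaptive_error hηP hsd.support_P hs (by positivity) hm hp hk (by linarith)
    hsignal hspos
  refine h1.trans ?_
  rw [← ENNReal.ofReal_natCast, ← ENNReal.ofReal_mul (Nat.cast_nonneg n),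
    ← ENNReal.ofReal_add (by positivity) (by positivity)]
  refine ENNReal.ofReal_le_ofReal (add_le_add ?_ ?_)
  · rw [hnp]
    refine Real.exp_le_exp.2 (neg_le_neg ?_)
    have : T ≤ L ^ 2 * T := le_mul_of_one_le_left hT.le (one_le_pow₀ hL)
    nlinarith
  · have hn : (0 : ℝ) < n := by
      rcases Nat.eq_zero_or_pos n with h | h
      · simp only [L, h, Nat.cast_zero, Real.log_zero] at hL; linarith
      · exact_mod_cast h
    rw [hthr]
    nth_rw 1 [← Real.exp_log hn]
    rw [← Real.exp_add]
    refine Real.exp_le_exp.2 ?_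
    change L + -(2 * ((d + L) * L)) ≤ -L ^ 2
    nlinarith [mul_nonneg hd0 (by linarith : (0 : ℝ) ≤ L)]

/-! ### Rates -/

/-- The local margin with exponent `b` holds, with the same constants, for all pairs of
regression functions admitted by the class. -/
def UniformLocalMargin (d : ℕ) (θ : Params) (b c₁ c₂ : ℝ) : Prop :=
  ∀ (Ω : Set (Cov d)) (ηP ηQ : Cov d → ℝ), HolderSmoothOn ηP Ω θ.Cβ θ.βP →
    HolderSmoothOn ηQ Ω θ.Cβ θ.βQ → RelativeSignal ηP ηQ Ω θ.Cγ θ.γ →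
    LocalMargin ηP ηQ Ω θ.γ b c₁ c₂

lemma exp_le_rate {θ : Params} (hθ : θ.Admissible) {c : ℝ} (hc : 0 < c) :
    ∃ C : ℝ, 0 < C ∧ ∀ τ : ℝ, 0 < τ →
      Real.exp (-(c * τ ^ (-(2 * θ.γ)))) ≤ C * τ ^ (1 + θ.α) := by
  have hγ := hθ.γ_pos
  have hα := hθ.α_nonneg
  obtain ⟨C, hC, h⟩ := exists_exp_neg_le_rpow hc (q := (1 + θ.α) / (2 * θ.γ)) (by positivity)
  refine ⟨C, hC, fun τ hτ => (h _ (by positivity)).trans (le_of_eq ?_)⟩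
  rw [← Real.rpow_mul hτ.le]
  congr 2
  field_simp

lemma tendsto_rpow_neg_nhds_zero {u : ℕ → ℝ} (hu : Tendsto u atTop atTop) {q : ℝ} (hq : 0 < q) :
    Tendsto (fun n => u n ^ (-q)) atTop (nhds 0) :=
  (tendsto_rpow_neg_atTop hq).comp hu

lemma eventually_small {τ : ℕ → ℝ} (hτ : Tendsto τ atTop (nhds 0)) {b ρ : ℝ} (hb : 0 < b)
    (hρ : 0 < ρ) (R : ℝ) : ∀ᶠ n in atTop, R * τ n ^ (1 / b) < ρ := by
  have h1 : Tendsto (fun n => R * τ n ^ (1 / b)) atTop (nhds (R * 0 ^ (1 / b))) :=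
    (hτ.rpow_const (Or.inr (by positivity))).const_mul R
  rw [Real.zero_rpow (by positivity), mul_zero] at h1
  exact h1.eventually_lt_const hρ

/-- The scale `τ = (n / ℓ) ^ (-b / (2γb + d))` balances bias and fluctuation. -/
lemma balance {n ℓ b γ D : ℝ} (hn : 0 < n) (hℓ : 0 < ℓ) (hb : 0 < b) (hD : 2 * γ * b + D ≠ 0) :
    n * ((n / ℓ) ^ (-(b / (2 * γ * b + D)))) ^ (D / b) =
      ℓ * ((n / ℓ) ^ (-(b / (2 * γ * b + D)))) ^ (-(2 * γ)) := by
  have hu : 0 < n / ℓ := by positivity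
  have hexp : -(b / (2 * γ * b + D)) * -(2 * γ) = 1 + -(b / (2 * γ * b + D)) * (D / b) := by
    obtain ⟨E, hE⟩ : ∃ E, E = 2 * γ * b + D := ⟨_, rfl⟩
    rw [← hE] at hD ⊢
    obtain rfl : D = E - 2 * γ * b := by rw [hE]; ring
    field_simp
    ring
  rw [← Real.rpow_mul hu.le, ← Real.rpow_mul hu.le, hexp,
    Real.rpow_add hu, Real.rpow_one]
  field_simp

theorem knn_rate {d : ℕ} (hd : 1 ≤ d) {θ : Params} (hθ : θ.Admissible) {b c₁ c₂ : ℝ} (hb : 0 < b)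
    (hc₁ : 0 < c₁) (hc₂ : 0 < c₂) (hmargin : UniformLocalMargin d θ b c₁ c₂)
    {k : ℕ → ℕ} {wP wQ : ℕ → ℝ} (hwP : ∀ n, 0 < wP n)
    (hk : (fun n : ℕ => (k n : ℝ)) =Θ[atTop]
      (fun n : ℕ => (n : ℝ) ^ (2 * θ.γ * b / (2 * θ.γ * b + d)))) :
    WorstCaseExcessRiskBound d θ (fun n => sourceClassifier (wP n) (wQ n) (k n))
      (fun n => (n : ℝ) ^ (-((1 + θ.α) * b / (2 * θ.γ * b + d)))) := by
  have hγ := hθ.γ_pos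
  have hα := hθ.α_nonneg
  have hD : 0 < 2 * θ.γ * b + d := by positivity
  have hV : 0 < θ.cLam ^ 2 * unitBallVol d :=
    mul_pos (pow_pos hθ.cLam_pos 2) (unitBallVol_pos d)
  obtain ⟨A', hA', hkA⟩ := hk.1.exists_pos
  obtain ⟨a', ha', hka⟩ := hk.2.exists_pos
  rw [IsBigOWith] at hkA hka
  set τ : ℕ → ℝ := fun n => (n : ℝ) ^ (-(b / (2 * θ.γ * b + d)))
  have hτ0 : Tendsto τ atTop (nhds 0) :=
    tendsto_rpow_neg_nhds_zero tendsto_natCast_atTop_atTop (by positivity)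
  -- a radius whose ball contains at least `2 k` sample points on average
  set R : ℝ := max 1 (2 * A' / (θ.cLam ^ 2 * unitBallVol d))
  have hR1 : 1 ≤ R := le_max_left _ _
  have hR0 : 0 < R := one_pos.trans_le hR1
  have hRA : 2 * A' ≤ θ.cLam ^ 2 * unitBallVol d * R ^ d := by
    have h1 : 2 * A' / (θ.cLam ^ 2 * unitBallVol d) ≤ R ^ d :=
      (le_max_right _ _).trans (le_self_pow₀ hR1 (by omega))
    rwa [div_le_iff₀' hV] at h1
  obtain ⟨K, hK, hexc⟩ := exists_excessRisk_le (A := (R / c₂) ^ b) (c := 2 * a'⁻¹ * c₁ ^ 2)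
    (C := θ.Cα) (by positivity) (by positivity) hγ hα
  obtain ⟨C, hC, hrate⟩ := exp_le_rate hθ (c := θ.cLam ^ 2 * unitBallVol d * R ^ d / 8)
    (by positivity)
  refine ⟨K + C, by positivity, ?_⟩
  filter_upwards [hkA, hka, eventually_small hτ0 hb hθ.rLam_pos R, eventually_gt_atTop 0]
    with n h1 h2 h3 hn PQ hPQ
  obtain ⟨Ω, ηP, ηQ, hηP, hηQ, hsd, hHP, hHQ, hTs, hrel⟩ := hPQ
  have hn' : (0 : ℝ) < n := by exact_mod_cast hn
  have hτ : 0 < τ n := by positivity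
  have hpow : (n : ℝ) ^ (2 * θ.γ * b / (2 * θ.γ * b + d)) = τ n ^ (-(2 * θ.γ)) := by
    simp only [τ]
    rw [← Real.rpow_mul hn'.le]; congr 1; field_simp
  rw [hpow] at h1 h2
  rw [Real.norm_of_nonneg (by positivity), Real.norm_of_nonneg (by positivity)] at h1 h2
  have hka' : a'⁻¹ * τ n ^ (-(2 * θ.γ)) ≤ k n := by
    rwa [inv_mul_le_iff₀ ha']
  have hk1 : 1 ≤ k n := by
    have : (0 : ℝ) < k n := lt_of_lt_of_le (by positivity) hka'
    exact_mod_cast this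
  have hfun : sourceClassifier (wP n) (wQ n) (k n) =
      fun (z : Fin n → Obs d) x => decide (1 / 2 ≤ knnEst (k n) z x) := by
    funext z x; exact sourceClassifier_eq (wQ n) (hwP n) hk1 z x
  rw [hfun]
  have hbal := balance (n := n) (ℓ := 1) (b := b) (γ := θ.γ) (D := d) hn' one_pos hb hD.ne'
  rw [div_one, one_mul] at hbal
  have hmain := hexc d n PQ.1 PQ.2 ηQ (fun z x => decide (1 / 2 ≤ knnEst (k n) z x)) Ω (τ n)
    (Real.exp (-(θ.cLam ^ 2 * unitBallVol d * R ^ d / 8 * τ n ^ (-(2 * θ.γ)))))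
    hηQ hTs hsd.support_Q (measurable_decide_half_le (measurable_knnEst (k n))) hτ
    (Real.exp_pos _).le (fun x hx hxτ => knn_error_at_scale hd hθ hηP hsd hb hc₁ hc₂
      (hmargin Ω ηP ηQ hHP hHQ hrel) hτ hbal hR0 h3 hRA hk1 hka' h1 hx hxτ)
  refine hmain.trans ?_
  have hre : (n : ℝ) ^ (-((1 + θ.α) * b / (2 * θ.γ * b + d))) = τ n ^ (1 + θ.α) := by
    simp only [τ]
    rw [← Real.rpow_mul hn'.le]; congr 1; field_simp
  rw [hre, add_mul]
  exact add_le_add le_rfl (hrate (τ n) hτ)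

lemma tendsto_div_log_sq : Tendsto (fun n : ℕ => (n : ℝ) / Real.log n ^ 2) atTop atTop := by
  have h1 : Tendsto (fun x : ℝ => Real.log x ^ 2 / x) atTop (nhds 0) :=
    (Real.isLittleO_pow_log_id_atTop (n := 2)).tendsto_div_nhds_zero
  have h2 : Tendsto (fun x : ℝ => Real.log x ^ 2 / x) atTop (nhdsWithin 0 (Set.Ioi 0)) := by
    refine tendsto_nhdsWithin_iff.2 ⟨h1, ?_⟩
    filter_upwards [eventually_gt_atTop 1] with x hx
    have := Real.log_pos hx
    exact Set.mem_Ioi.2 (by positivity)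
  refine (h2.inv_tendsto_nhdsGT_zero.comp tendsto_natCast_atTop_atTop).congr fun n => ?_
  simp [inv_div]

theorem adaptive_rate {d : ℕ} (hd : 1 ≤ d) {θ : Params} (hθ : θ.Admissible) {b c₁ c₂ : ℝ}
    (hb : 0 < b) (hc₁ : 0 < c₁) (hc₂ : 0 < c₂) (hmargin : UniformLocalMargin d θ b c₁ c₂) :
    WorstCaseExcessRiskBound d θ (fun _ => adaptiveClassifier)
      (fun n => ((n : ℝ) / Real.log n ^ 2) ^ (-((1 + θ.α) * b / (2 * θ.γ * b + d)))) := by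
  have hγ := hθ.γ_pos
  have hα := hθ.α_nonneg
  have hD : 0 < 2 * θ.γ * b + d := by positivity
  have hV : 0 < θ.cLam ^ 2 * unitBallVol d :=
    mul_pos (pow_pos hθ.cLam_pos 2) (unitBallVol_pos d)
  set τ : ℕ → ℝ := fun n => ((n : ℝ) / Real.log n ^ 2) ^ (-(b / (2 * θ.γ * b + d)))
  have hτ0 : Tendsto τ atTop (nhds 0) :=
    tendsto_rpow_neg_nhds_zero tendsto_div_log_sq (by positivity)
  set q := (1 + θ.α) * b / (2 * θ.γ * b + d)
  have hq : 0 < q := by positivity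
  -- at distance `A * τ` from `1/2` the signal exceeds twice the threshold
  set A₀ : ℝ := (17 * (d + 1) / (θ.cLam ^ 2 * unitBallVol d * c₁ ^ 2)) ^ (1 / (2 * θ.γ))
  set A : ℝ := max ((1 / c₂) ^ b) A₀
  have hA0 : 0 < A := lt_of_lt_of_le (by positivity) (le_max_left _ _)
  have hA' : 16 * (d + 1) < θ.cLam ^ 2 * unitBallVol d * c₁ ^ 2 * A ^ (2 * θ.γ) := by
    have h1 : A₀ ^ (2 * θ.γ) = 17 * (d + 1) / (θ.cLam ^ 2 * unitBallVol d * c₁ ^ 2) := by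
      simp only [A₀]
      rw [← Real.rpow_mul (by positivity), one_div_mul_cancel (by positivity), Real.rpow_one]
    have h2 : A₀ ^ (2 * θ.γ) ≤ A ^ (2 * θ.γ) :=
      Real.rpow_le_rpow (by positivity) (le_max_right _ _) (by positivity)
    rw [h1, div_le_iff₀' (by positivity)] at h2
    have hd0 : (0 : ℝ) ≤ d := Nat.cast_nonneg d
    linarith
  obtain ⟨K, hK, hexc⟩ := exists_excessRisk_le (A := A) (c := 1)
    (C := θ.Cα) hA0 one_pos hγ hα
  obtain ⟨C, hC, hrate⟩ := exp_le_rate hθ (c := θ.cLam ^ 2 * unitBallVol d / 8) (by positivity)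
  refine ⟨K + (C + 1), by positivity, ?_⟩
  have hlog : Tendsto (fun n : ℕ => Real.log n) atTop atTop :=
    Real.tendsto_log_atTop.comp tendsto_natCast_atTop_atTop
  filter_upwards [eventually_small hτ0 hb hθ.rLam_pos 1, hτ0.eventually_lt_const one_pos,
    hlog.eventually_ge_atTop 1, hlog.eventually_ge_atTop q,
    hlog.eventually_ge_atTop (2 / (θ.cLam ^ 2 * unitBallVol d)),
    eventually_gt_atTop 0] with n h1 h2 hL hLq hLV hn PQ hPQ
  obtain ⟨Ω, ηP, ηQ, hηP, hηQ, hsd, hHP, hHQ, hTs, hrel⟩ := hPQ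
  have hn' : (0 : ℝ) < n := by exact_mod_cast hn
  have hL0 : 0 < Real.log n := by linarith
  have hu : 0 < (n : ℝ) / Real.log n ^ 2 := by positivity
  have hτ : 0 < τ n := by positivity
  have hL2 : Real.log n ≤ Real.log n ^ 2 := le_self_pow₀ hL two_ne_zero
  have hbal := balance (n := n) (ℓ := Real.log n ^ 2) (b := b) (γ := θ.γ) (D := d) hn'
    (by positivity) hb hD.ne'
  have hT1 : 1 ≤ τ n ^ (-(2 * θ.γ)) :=
    Real.one_le_rpow_of_pos_of_le_one_of_nonpos hτ h2.le (by linarith)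
  have hbig : 2 ≤ θ.cLam ^ 2 * unitBallVol d * (Real.log n ^ 2 * τ n ^ (-(2 * θ.γ))) := by
    rw [div_le_iff₀' hV] at hLV
    calc 2 ≤ θ.cLam ^ 2 * unitBallVol d * Real.log n := hLV
      _ ≤ θ.cLam ^ 2 * unitBallVol d * (Real.log n ^ 2 * τ n ^ (-(2 * θ.γ))) := by
        refine mul_le_mul_of_nonneg_left ?_ hV.le
        exact hL2.trans (le_mul_of_one_le_right (by positivity) hT1)
  have hre : ((n : ℝ) / Real.log n ^ 2) ^ (-q) = τ n ^ (1 + θ.α) := by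
    simp only [τ, q]
    rw [← Real.rpow_mul hu.le]; congr 1; field_simp
  have hmain := hexc d n PQ.1 PQ.2 ηQ adaptiveClassifier Ω (τ n)
    (Real.exp (-(θ.cLam ^ 2 * unitBallVol d / 8 * τ n ^ (-(2 * θ.γ)))) +
      Real.exp (-Real.log n ^ 2))
    hηQ hTs hsd.support_Q (measurable_adaptiveClassifier d n) hτ
    (by positivity) (fun x hx hxτ => (adaptive_error_at_scale hd hθ hηP hsd hb hc₁ hc₂
      (hmargin Ω ηP ηQ hHP hHQ hrel) hτ hL hbal (by rwa [one_mul] at h1) hbig (le_max_left _ _)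
      hA' hx hxτ).trans (ENNReal.ofReal_le_ofReal (le_add_of_nonneg_right (Real.exp_pos _).le)))
  refine hmain.trans ?_
  have hlogterm : Real.exp (-Real.log n ^ 2) ≤ τ n ^ (1 + θ.α) := by
    rw [← hre]
    calc Real.exp (-Real.log n ^ 2) ≤ Real.exp (Real.log n * -q) :=
          Real.exp_le_exp.2 (by nlinarith)
      _ = (n : ℝ) ^ (-q) := (Real.rpow_def_of_pos hn' _).symm
      _ ≤ _ := Real.rpow_le_rpow_of_nonpos hu (div_le_self hn'.le (one_le_pow₀ hL)) (by linarith)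
  rw [hre, add_mul, add_mul, one_mul]
  exact add_le_add le_rfl (add_le_add (hrate (τ n) hτ) hlogterm)

end PosteriorDrift

theorem theorem1 (d : ℕ) (hd : 1 ≤ d) (θ : PosteriorDrift.Params) (hθ : θ.Admissible) :
    -- the weighted kNN classifier, source smoothness dominating
    (θ.γ * θ.βQ < θ.βP → ∀ (k : ℕ → ℕ) (wP wQ : ℕ → ℝ), (∀ n, 0 < wP n) → (∀ n, 0 < wQ n) →
      (fun n : ℕ => (k n : ℝ)) =Θ[Filter.atTop]
        (fun n : ℕ => (n : ℝ) ^ (2 * θ.βP / (2 * θ.βP + d))) →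
      PosteriorDrift.WorstCaseExcessRiskBound d θ
        (fun n => PosteriorDrift.sourceClassifier (wP n) (wQ n) (k n))
        (fun n => (n : ℝ) ^ (-((1 + θ.α) * θ.βP / (θ.γ * (2 * θ.βP + d)))))) ∧
    -- the weighted kNN classifier, target smoothness dominating
    (θ.βP ≤ θ.γ * θ.βQ → ∀ (k : ℕ → ℕ) (wP wQ : ℕ → ℝ), (∀ n, 0 < wP n) → (∀ n, 0 < wQ n) →
      (fun n : ℕ => (k n : ℝ)) =Θ[Filter.atTop]
        (fun n : ℕ => (n : ℝ) ^ (2 * θ.γ * θ.βQ / (2 * θ.γ * θ.βQ + d))) →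
      PosteriorDrift.WorstCaseExcessRiskBound d θ
        (fun n => PosteriorDrift.sourceClassifier (wP n) (wQ n) (k n))
        (fun n => (n : ℝ) ^ (-((1 + θ.α) * θ.βQ / (2 * θ.γ * θ.βQ + d))))) ∧
    -- the adaptive classifier, source smoothness dominating
    (θ.γ * θ.βQ < θ.βP →
      PosteriorDrift.WorstCaseExcessRiskBound d θ
        (fun _ => PosteriorDrift.adaptiveClassifier)
        (fun n => ((n : ℝ) / Real.log n ^ 2) ^
          (-((1 + θ.α) * θ.βP / (θ.γ * (2 * θ.βP + d)))))) ∧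
    -- the adaptive classifier, target smoothness dominating
    (θ.βP ≤ θ.γ * θ.βQ →
      PosteriorDrift.WorstCaseExcessRiskBound d θ
        (fun _ => PosteriorDrift.adaptiveClassifier)
        (fun n => ((n : ℝ) / Real.log n ^ 2) ^
          (-((1 + θ.α) * θ.βQ / (2 * θ.γ * θ.βQ + d))))) := by
  have hγ := hθ.γ_pos
  have hCβ := hθ.Cβ_pos
  have hCγ := hθ.Cγ_pos
  have source : θ.γ * θ.βQ < θ.βP → 0 < θ.βP ∧ PosteriorDrift.UniformLocalMargin d θ (θ.βP / θ.γ)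
      (θ.Cγ / 2) ((θ.Cγ / (2 * θ.Cβ)) ^ (1 / θ.βP)) := by
    intro h
    have hβ : 0 < θ.βP := lt_of_le_of_lt (mul_nonneg hγ.le hθ.βQ_mem.1) h
    exact ⟨hβ, fun Ω ηP ηQ hP _ hrel =>
      PosteriorDrift.localMargin_of_source_smooth hCβ hβ hCγ hγ hP hrel⟩
  have target : θ.βP ≤ θ.γ * θ.βQ → 0 < θ.βQ ∧ PosteriorDrift.UniformLocalMargin d θ θ.βQ
      (θ.Cγ / 2 ^ θ.γ) ((1 / (2 * θ.Cβ)) ^ (1 / θ.βQ)) := by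
    intro h
    have hβ : 0 < θ.βQ := by
      refine hθ.βQ_mem.1.lt_of_ne' fun h0 => ?_
      rw [h0, mul_zero] at h
      have hmax := hθ.max_pos
      rw [h0, max_eq_right h] at hmax
      exact lt_irrefl _ hmax
    exact ⟨hβ, fun Ω ηP ηQ _ hQ hrel =>
      PosteriorDrift.localMargin_of_target_smooth hCβ hβ hCγ hγ hQ hrel⟩
  have hmul : 2 * θ.γ * (θ.βP / θ.γ) = 2 * θ.βP := by field_simp
  have hexp : (1 + θ.α) * (θ.βP / θ.γ) / (2 * θ.βP + d) =
      (1 + θ.α) * θ.βP / (θ.γ * (2 * θ.βP + d)) := by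
    rw [← mul_div_assoc, div_div]
  refine ⟨fun h k wP wQ hwP _ hk => ?_, fun h k wP wQ hwP _ hk => ?_, fun h => ?_, fun h => ?_⟩
  · obtain ⟨hβ, hm⟩ := source h
    have := PosteriorDrift.knn_rate (wQ := wQ) hd hθ (div_pos hβ hγ) (by positivity)
      (by positivity) hm hwP (by rwa [hmul])
    rwa [hmul, hexp] at this
  · obtain ⟨hβ, hm⟩ := target h
    exact PosteriorDrift.knn_rate hd hθ hβ (by positivity) (by positivity) hm hwP hk
  · obtain ⟨hβ, hm⟩ := source h
    have := PosteriorDrift.adaptive_rate hd hθ (div_pos hβ hγ) (by positivity)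
      (by positivity) hm
    rwa [hmul, hexp] at this
  · obtain ⟨hβ, hm⟩ := target h
    exact PosteriorDrift.adaptive_rate hd hθ hβ (by positivity) (by positivity) hm
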